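/- Let $N$ be a simply connected nilpotent (real, finite-dimensional) Lie group and let $\Lambda \subset \Gamma \subset N$ be lattices, i.e. discrete subgroups such that $N/\Lambda$ and $N/\Gamma$ carry nonzero finite $N$-invariant Borel measures. Let $\beta \in \mathrm{Aut}(N)$ be a Lie group automorphism whose differential $d\beta : \mathrm{Lie}(N) \to \mathrm{Lie}(N)$ has no complex eigenvalue of absolute value $1$, and suppose that $\beta(\Lambda) \subset \Gamma$. Let $k : \Gamma \to \mathbb{Z}$ be a homomorphism satisfying $k(\beta(\lambda)) = k(\lambda)$ for all $\lambda \in \Lambda$. Then $k$ is trivial, i.e. $k(\gamma) = 0$ for every $\gamma \in \Gamma$. -/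

import Mathlib

open MeasureTheory
open scoped Manifold ContDiff

/-- A subgroup `Γ` of a topological group `G` is a lattice if it is discrete and the homogeneous
space `G ⧸ Γ` carries a nonzero finite `G`-invariant Borel measure (finite covolume). -/
def IsLatticeSubgroup {G : Type*} [Group G] [TopologicalSpace G] (Γ : Subgroup G) : Prop :=
  DiscreteTopology Γ ∧
    letI : MeasurableSpace (G ⧸ Γ) := borel (G ⧸ Γ)
    ∃ μ : Measure (G ⧸ Γ), μ ≠ 0 ∧ IsFiniteMeasure μ ∧ SMulInvariantMeasure G (G ⧸ Γ) μ

/-- An automorphism of the Lie group `N`: a group automorphism that is smooth with smooth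
inverse. -/
structure LieGroupAut (E : Type*) [NormedAddCommGroup E] [NormedSpace ℝ E]
    (N : Type*) [TopologicalSpace N] [ChartedSpace E N] [Group N] extends N ≃* N where
  contMDiff_toFun : ContMDiff 𝓘(ℝ, E) 𝓘(ℝ, E) ∞ toFun
  contMDiff_invFun : ContMDiff 𝓘(ℝ, E) 𝓘(ℝ, E) ∞ invFun

/-- The differential at the identity of a Lie group automorphism, as an endomorphism of
`Lie(N) = T₁N`. The derivative takes values in the tangent space at `β 1`, which is the tangent
space at `1` because `β 1 = 1` (every tangent space is by definition the model space, read in the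
preferred chart at the base point, so no transport is needed). -/
noncomputable def LieGroupAut.differential {E : Type*} [NormedAddCommGroup E] [NormedSpace ℝ E]
    {N : Type*} [TopologicalSpace N] [ChartedSpace E N] [Group N] (β : LieGroupAut E N) :
    GroupLieAlgebra 𝓘(ℝ, E) N →ₗ[ℝ] GroupLieAlgebra 𝓘(ℝ, E) N :=
  (mfderiv 𝓘(ℝ, E) 𝓘(ℝ, E) β.toMulEquiv (1 : N) :
    TangentSpace 𝓘(ℝ, E) (1 : N) →L[ℝ] TangentSpace 𝓘(ℝ, E) (1 : N)).toLinearMap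

/-- A real linear endomorphism has no (complex) eigenvalue on the unit circle; the complex
eigenvalues are the eigenvalues of the complexification. -/
def NoEigenvalueOnUnitCircle {V : Type*} [AddCommGroup V] [Module ℝ V] (f : V →ₗ[ℝ] V) : Prop :=
  ∀ z : ℂ, Module.End.HasEigenvalue (LinearMap.baseChange ℂ f) z → ‖z‖ ≠ 1

/-! Extend `k` to `F : N → ℝ` with `F (g * γ) = F g + k γ`. The lattice `Γ` is cocompact, so left
translation by `u` displaces `F` by a bounded amount; let `L u` be the supremum of this displacement
and `ℓ u = lim L (u ^ n) / n` its stable length. Evaluating at `1` gives `|k γ| ≤ ℓ γ`, so it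
suffices that `ℓ = 0`.

Three properties of `ℓ` force this. It is subadditive because `N` is nilpotent
(`IsLength.stableLength_mul_le`): a commutator of `j`-th powers costs `O(j)` but represents a `j ^
2`-th power, so commutator corrections are free. It is `β`-invariant
(`stableLength_displacement_mulEquiv`): `k ∘ β = k` on the cocompact `Λ` keeps `F ∘ β - F` bounded,
and bounded errors vanish in the limit. It is `O(‖x‖)` in a chart at `1`, since powers of small
elements move away at most linearly.

The growth rate of `ℓ` at `1` is then a `dβ`-invariant seminorm on the Lie algebra, hence zero, as
`dβ` has no eigenvalue on the unit circle. By subadditivity `ℓ` has zero derivative at every point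
near `1`, so it vanishes near `1` (`IsLength.eventually_stableLength_eq_zero`), and by connectedness
everywhere. -/

section

open Filter Topology
open scoped commutatorElement Pointwise

/-- A nonnegative subadditive function on a group, invariant under inversion. -/
structure IsLength {G : Type*} [Group G] (L : G → ℝ) : Prop where
  nonneg : ∀ g, 0 ≤ L g
  mul_le : ∀ g h, L (g * h) ≤ L g + L h
  inv : ∀ g, L g⁻¹ = L g
  one : L 1 = 0

/-- The stable length `lim L (g ^ n) / n`. -/
noncomputable def stableLength {G : Type*} [Group G] (L : G → ℝ) (g : G) : ℝ :=
  ⨅ n : {n : ℕ // 1 ≤ n}, L (g ^ (n : ℕ)) / (n : ℕ)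

/-! ### Stable lengths and their subadditivity on nilpotent groups -/

section Length

variable {G : Type*} [Group G] {L : G → ℝ}

theorem IsLength.pow_le (hL : IsLength L) (g : G) (n : ℕ) : L (g ^ n) ≤ n * L g := by
  induction n with
  | zero => simp [hL.one]
  | succ n ih =>
    rw [pow_succ]
    push_cast
    linarith [hL.mul_le (g ^ n) g]

theorem IsLength.bddBelow (hL : IsLength L) (g : G) :
    BddBelow (Set.range fun n : {n : ℕ // 1 ≤ n} => L (g ^ (n : ℕ)) / (n : ℕ)) :=
  ⟨0, by rintro _ ⟨n, rfl⟩; exact div_nonneg (hL.nonneg _) (Nat.cast_nonneg _)⟩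

theorem IsLength.stableLength_le (hL : IsLength L) (g : G) {n : ℕ} (hn : 1 ≤ n) :
    stableLength L g ≤ L (g ^ n) / n :=
  ciInf_le (hL.bddBelow g) ⟨n, hn⟩

theorem IsLength.stableLength_le_self (hL : IsLength L) (g : G) : stableLength L g ≤ L g := by
  simpa using hL.stableLength_le g le_rfl

theorem le_stableLength {g : G} {c : ℝ} (h : ∀ n : ℕ, 1 ≤ n → c * n ≤ L (g ^ n)) :
    c ≤ stableLength L g := by
  have : Nonempty {n : ℕ // 1 ≤ n} := ⟨⟨1, le_rfl⟩⟩
  refine le_ciInf fun n => ?_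
  have : (0 : ℝ) < (n : ℕ) := by exact_mod_cast n.2
  rw [le_div_iff₀ this]
  exact h n n.2

theorem IsLength.stableLength_nonneg (hL : IsLength L) (g : G) : 0 ≤ stableLength L g :=
  le_stableLength fun n _ => by simpa using hL.nonneg _

theorem exists_lt_of_stableLength_lt {g : G} {c : ℝ} (h : stableLength L g < c) :
    ∃ n : ℕ, 1 ≤ n ∧ L (g ^ n) < c * n := by
  have : Nonempty {n : ℕ // 1 ≤ n} := ⟨⟨1, le_rfl⟩⟩
  obtain ⟨n, hn⟩ := exists_lt_of_ciInf_lt h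
  have : (0 : ℝ) < (n : ℕ) := by exact_mod_cast n.2
  exact ⟨n, n.2, (div_lt_iff₀ this).1 hn⟩

theorem IsLength.stableLength_inv (hL : IsLength L) (g : G) :
    stableLength L g⁻¹ = stableLength L g := by
  simp [stableLength, hL.inv]

theorem IsLength.stableLength_one (hL : IsLength L) : stableLength L (1 : G) = 0 :=
  le_antisymm (by simpa [hL.one] using hL.stableLength_le_self (1 : G)) (hL.stableLength_nonneg _)

theorem IsLength.mul_stableLength_le (hL : IsLength L) (g : G) (n : ℕ) :
    n * stableLength L g ≤ L (g ^ n) := by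
  rcases Nat.eq_zero_or_pos n with rfl | hn
  · simp [hL.one]
  · have := hL.stableLength_le g hn
    rw [le_div_iff₀ (by exact_mod_cast hn)] at this
    linarith

/-- Lengths that differ by a bounded amount along powers have comparable stable lengths. -/
theorem IsLength.stableLength_le_of_bounded (hL : IsLength L) {H : Type*} [Group H]
    {M : H → ℝ} (hM : IsLength M) (g : G) (h : H) (C : ℝ)
    (hC : ∀ n : ℕ, L (g ^ n) ≤ M (h ^ n) + C) : stableLength L g ≤ stableLength M h := by
  refine le_of_forall_pos_lt_add fun ε hε => ?_
  obtain ⟨n, hn, hlt⟩ := exists_lt_of_stableLength_lt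
    (show stableLength M h < stableLength M h + ε / 2 by linarith)
  -- Passing to the exponent `n * j` makes the additive error `C` smaller than `j * (ε / 2)`.
  obtain ⟨j, hj⟩ := exists_nat_gt (max 1 (C / (ε / 2)))
  have hj1 : (1 : ℝ) < j := lt_of_le_of_lt (le_max_left _ _) hj
  have hj2 : C < j * (ε / 2) := by
    rw [← div_lt_iff₀ (by linarith)]; exact lt_of_le_of_lt (le_max_right _ _) hj
  have hn' : (1 : ℝ) ≤ n := by exact_mod_cast hn
  have h1 := hL.mul_stableLength_le g (n * j)
  have h2 := hC (n * j)
  have h3 := hM.pow_le (h ^ n) j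
  rw [← pow_mul] at h3
  push_cast at h1
  have hnj : (0 : ℝ) < n * j := by positivity
  have h4 : j * M (h ^ n) ≤ j * ((stableLength M h + ε / 2) * n) := by gcongr
  have h5 : (j : ℝ) * (ε / 2) ≤ n * j * (ε / 2) := by
    have : (0 : ℝ) ≤ j * (ε / 2) := by positivity
    nlinarith
  have h6 : n * j * stableLength L g < n * j * (stableLength M h + ε) := by nlinarith
  exact lt_of_mul_lt_mul_left h6 hnj.le

/-- Some power `q ^ M` has a lift of length at most `(c + ε) * M`. -/
def StablyLifts {Q : Type*} [Group Q] (L : G → ℝ) (π : G →* Q) (q : Q) (c : ℝ) : Prop :=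
  ∀ ε > 0, ∃ M : ℕ, 0 < M ∧ ∃ w, π w = q ^ M ∧ L w ≤ (c + ε) * M

variable {Q : Type*} [Group Q] {π : G →* Q}

theorem stablyLifts_map (g : G) : StablyLifts L π (π g) (L g) :=
  fun ε hε => ⟨1, one_pos, g, by simp, by simpa using hε.le⟩

theorem stablyLifts_stableLength (g : G) : StablyLifts L π (π g) (stableLength L g) := by
  intro ε hε
  obtain ⟨n, hn, hlt⟩ := exists_lt_of_stableLength_lt
    (show stableLength L g < stableLength L g + ε by linarith)
  exact ⟨n, hn, g ^ n, by simp, hlt.le⟩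

/-- Commuting elements satisfy `(q * r) ^ (m * n) = (q ^ m) ^ n * (r ^ n) ^ m`, so powers of the two
lifts can be multiplied. -/
theorem StablyLifts.mul (hL : IsLength L) {q r : Q} {c d : ℝ} (hq : StablyLifts L π q c)
    (hr : StablyLifts L π r d) (hqr : Commute q r) : StablyLifts L π (q * r) (c + d) := by
  intro ε hε
  obtain ⟨m, hm, v, hv, hv'⟩ := hq (ε / 2) (by linarith)
  obtain ⟨n, hn, w, hw, hw'⟩ := hr (ε / 2) (by linarith)
  refine ⟨m * n, Nat.mul_pos hm hn, v ^ n * w ^ m, ?_, ?_⟩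
  · rw [map_mul, map_pow, map_pow, hv, hw, hqr.mul_pow, ← pow_mul, ← pow_mul, mul_comm n m]
  · have h1 := hL.mul_le (v ^ n) (w ^ m)
    have h2 := hL.pow_le v n
    have h3 := hL.pow_le w m
    have h4 : n * L v ≤ n * ((c + ε / 2) * m) := by gcongr
    have h5 : m * L w ≤ m * ((d + ε / 2) * n) := by gcongr
    push_cast
    nlinarith

theorem StablyLifts.inv (hL : IsLength L) {q : Q} {c : ℝ} (hq : StablyLifts L π q c) :
    StablyLifts L π q⁻¹ c := by
  intro ε hε
  obtain ⟨m, hm, v, hv, hv'⟩ := hq ε hε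
  exact ⟨m, hm, v⁻¹, by simp [hv], by rwa [hL.inv]⟩

theorem StablyLifts.of_pow {q : Q} {c : ℝ} {M : ℕ} (hM : 0 < M)
    (hq : StablyLifts L π (q ^ M) (c * M)) : StablyLifts L π q c := by
  intro ε hε
  have hM' : (0 : ℝ) < M := by exact_mod_cast hM
  obtain ⟨m, hm, v, hv, hv'⟩ := hq (ε * M) (by positivity)
  refine ⟨M * m, Nat.mul_pos hM hm, v, by rw [hv, pow_mul], ?_⟩
  push_cast
  linarith

theorem StablyLifts.of_forall_add {q : Q} {c : ℝ}
    (hq : ∀ ε > 0, StablyLifts L π q (c + ε)) : StablyLifts L π q c := by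
  intro ε hε
  obtain ⟨m, hm, v, hv, hv'⟩ := hq (ε / 2) (by linarith) (ε / 2) (by linarith)
  exact ⟨m, hm, v, hv, by rwa [add_assoc, add_halves] at hv'⟩

theorem commutatorElement_pow_pow {a b : Q} (ha : Commute ⁅a, b⁆ a) (hb : Commute ⁅a, b⁆ b)
    (m n : ℕ) : ⁅a ^ m, b ^ n⁆ = ⁅a, b⁆ ^ (m * n) := by
  have key : ∀ n : ℕ, a * b ^ n = ⁅a, b⁆ ^ n * (b ^ n * a) := by
    intro n
    induction n with
    | zero => simp
    | succ n ih =>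
      have h1 : a * b = ⁅a, b⁆ * (b * a) := by simp [commutatorElement_def, mul_assoc]
      calc a * b ^ (n + 1) = (a * b ^ n) * b := by rw [pow_succ, mul_assoc]
        _ = ⁅a, b⁆ ^ n * (b ^ n * (a * b)) := by rw [ih]; simp only [mul_assoc]
        _ = ⁅a, b⁆ ^ n * ((b ^ n * ⁅a, b⁆) * (b * a)) := by rw [h1]; simp only [mul_assoc]
        _ = ⁅a, b⁆ ^ n * ((⁅a, b⁆ * b ^ n) * (b * a)) := by rw [(hb.pow_right n).eq]
        _ = ⁅a, b⁆ ^ (n + 1) * (b ^ (n + 1) * a) := by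
          rw [pow_succ, pow_succ]; simp only [mul_assoc]
  have key2 : ∀ m : ℕ, a ^ m * b ^ n = ⁅a, b⁆ ^ (m * n) * (b ^ n * a ^ m) := by
    intro m
    induction m with
    | zero => simp
    | succ m ih =>
      calc a ^ (m + 1) * b ^ n = a * (a ^ m * b ^ n) := by rw [pow_succ', mul_assoc]
        _ = (a * ⁅a, b⁆ ^ (m * n)) * (b ^ n * a ^ m) := by rw [ih]; simp only [mul_assoc]
        _ = ⁅a, b⁆ ^ (m * n) * ((a * b ^ n) * a ^ m) := by
          rw [← (ha.pow_left (m * n)).eq]; simp only [mul_assoc]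
        _ = ⁅a, b⁆ ^ ((m + 1) * n) * (b ^ n * a ^ (m + 1)) := by
          rw [key, add_mul, one_mul, pow_add, pow_succ']; simp only [mul_assoc]
  rw [commutatorElement_def, key2]
  group

/-- The lift `⁅x ^ j, y ^ j⁆` of the `j ^ 2`-th power has length at most `2 * j * (L x + L y)`,
which is negligible against `j ^ 2`. -/
theorem IsLength.stablyLifts_commutator (hL : IsLength L) (hπ : Function.Surjective π) {a b : Q}
    (ha : Commute ⁅a, b⁆ a) (hb : Commute ⁅a, b⁆ b) : StablyLifts L π ⁅a, b⁆ 0 := by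
  intro ε hε
  obtain ⟨x, rfl⟩ := hπ a
  obtain ⟨y, rfl⟩ := hπ b
  obtain ⟨j, hj⟩ := exists_nat_gt (max 1 (2 * (L x + L y) / ε))
  have hj1 : (1 : ℝ) < j := lt_of_le_of_lt (le_max_left _ _) hj
  have hj2 : 2 * (L x + L y) < j * ε := by
    rw [← div_lt_iff₀ hε]; exact lt_of_le_of_lt (le_max_right _ _) hj
  have hj0 : 0 < j := by exact_mod_cast (zero_lt_one.trans hj1)
  refine ⟨j * j, Nat.mul_pos hj0 hj0, ⁅x ^ j, y ^ j⁆, ?_, ?_⟩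
  · rw [map_commutatorElement, map_pow, map_pow, commutatorElement_pow_pow ha hb]
  · rw [commutatorElement_def]
    have h1 := hL.mul_le (x ^ j * y ^ j * (x ^ j)⁻¹) (y ^ j)⁻¹
    have h2 := hL.mul_le (x ^ j * y ^ j) (x ^ j)⁻¹
    have h3 := hL.mul_le (x ^ j) (y ^ j)
    rw [hL.inv] at h1 h2
    have h4 := hL.pow_le x j
    have h5 := hL.pow_le y j
    push_cast
    nlinarith

theorem IsLength.stablyLifts_of_mem_lowerCentralSeries (hL : IsLength L) (i : ℕ) {c : G}
    (hc : c ∈ (⊤ : Subgroup G).lowerCentralSeries (i + 1)) :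
    StablyLifts L (QuotientGroup.mk' ((⊤ : Subgroup G).lowerCentralSeries (i + 2))) c 0 := by
  set π := QuotientGroup.mk' ((⊤ : Subgroup G).lowerCentralSeries (i + 2)) with hπ
  have hcentral : ∀ x ∈ (⊤ : Subgroup G).lowerCentralSeries (i + 1), ∀ y, Commute (π x) (π y) := by
    intro x hx y
    rw [← commutatorElement_eq_one_iff_commute, ← map_commutatorElement, hπ,
      QuotientGroup.mk'_apply, QuotientGroup.eq_one_iff]
    exact Subgroup.commutator_mem_commutator hx (Subgroup.mem_top y)
  change StablyLifts L π (π c) 0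
  have hc' := hc
  rw [Subgroup.mem_lowerCentralSeries_succ_iff] at hc'
  induction hc' using Subgroup.closure_induction with
  | mem x hx =>
    obtain ⟨a, ha, b, -, rfl⟩ := hx
    have := hcentral _ hc
    rw [map_commutatorElement] at this ⊢
    refine hL.stablyLifts_commutator (QuotientGroup.mk'_surjective _) ?_ ?_
    · exact this a
    · exact this b
  | one =>
    intro ε hε
    exact ⟨1, one_pos, 1, (pow_one _).symm, by rw [hL.one]; simpa using hε.le⟩
  | mul x y hx hy ihx ihy =>
    have h := (ihx hx).mul hL (ihy hy) (hcentral x hx y)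
    rwa [← map_mul, add_zero] at h
  | inv x hx ih => rw [map_inv]; exact (ih hx).inv hL

/-- A lift `w` of `g ^ M` errs by an element of the previous term of the series. That error is
central in the new quotient and lifts at zero stable cost, so the bound survives. -/
theorem IsLength.stablyLifts_succ (hL : IsLength L) (i : ℕ) {g : G} {t : ℝ}
    (hg : StablyLifts L (QuotientGroup.mk' ((⊤ : Subgroup G).lowerCentralSeries (i + 1))) g t) :
    StablyLifts L (QuotientGroup.mk' ((⊤ : Subgroup G).lowerCentralSeries (i + 2))) g t := by
  refine StablyLifts.of_forall_add fun ε hε => ?_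
  obtain ⟨M, hM, w, hw, hle⟩ := hg ε hε
  refine StablyLifts.of_pow hM ?_
  have hmem : w⁻¹ * g ^ M ∈ (⊤ : Subgroup G).lowerCentralSeries (i + 1) := by
    rw [← QuotientGroup.eq]; exact hw
  have hcomm : Commute (QuotientGroup.mk' ((⊤ : Subgroup G).lowerCentralSeries (i + 2)) w)
      (QuotientGroup.mk' ((⊤ : Subgroup G).lowerCentralSeries (i + 2)) (w⁻¹ * g ^ M)) := by
    refine Commute.symm ?_
    rw [← commutatorElement_eq_one_iff_commute, ← map_commutatorElement,
      QuotientGroup.mk'_apply, QuotientGroup.eq_one_iff]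
    exact Subgroup.commutator_mem_commutator hmem (Subgroup.mem_top w)
  have h := (stablyLifts_map w).mul hL (hL.stablyLifts_of_mem_lowerCentralSeries i hmem) hcomm
  rw [QuotientGroup.mk'_apply, ← QuotientGroup.mk_mul, mul_inv_cancel_left, add_zero] at h
  intro δ hδ
  obtain ⟨m, hm, v, hv, hv'⟩ := h δ hδ
  refine ⟨m, hm, v, hv, hv'.trans ?_⟩
  gcongr

/-- In a nilpotent group the stable length of any length function is subadditive. -/
theorem IsLength.stableLength_mul_le [Group.IsNilpotent G] (hL : IsLength L) (g h : G) :
    stableLength L (g * h) ≤ stableLength L g + stableLength L h := by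
  have key : ∀ i, StablyLifts L
      (QuotientGroup.mk' ((⊤ : Subgroup G).lowerCentralSeries (i + 1))) (g * h : G)
      (stableLength L g + stableLength L h) := by
    intro i
    induction i with
    -- `lowerCentralSeries 1` is the commutator subgroup: the induction starts in the
    -- abelianization, where `g` and `h` commute.
    | zero =>
      refine StablyLifts.mul hL (stablyLifts_stableLength g) (stablyLifts_stableLength h) ?_
      rw [← commutatorElement_eq_one_iff_commute, ← map_commutatorElement,
        QuotientGroup.mk'_apply, QuotientGroup.eq_one_iff]
      exact Subgroup.commutator_mem_commutator (Subgroup.mem_top g) (Subgroup.mem_top h)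
    | succ i ih => exact hL.stablyLifts_succ i ih
  obtain ⟨n, hn⟩ := Subgroup.nilpotent_iff_lowerCentralSeries.1 ‹Group.IsNilpotent G›
  have hn' : (⊤ : Subgroup G).lowerCentralSeries (n + 1) = ⊥ :=
    le_bot_iff.1 (hn ▸ Subgroup.lowerCentralSeries_antitone _ (Nat.le_succ n))
  refine le_of_forall_pos_le_add fun ε hε => ?_
  obtain ⟨M, hM, w, hw, hle⟩ := key n ε hε
  -- The quotient is now by the trivial subgroup, so the lift is the power itself.
  have hw' : w = (g * h) ^ M := by
    have : w⁻¹ * (g * h) ^ M ∈ (⊤ : Subgroup G).lowerCentralSeries (n + 1) := by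
      rw [← QuotientGroup.eq]; exact hw
    rw [hn', Subgroup.mem_bot, inv_mul_eq_one] at this
    exact this
  have hM' : (0 : ℝ) < M := by exact_mod_cast hM
  have := (hL.mul_stableLength_le (g * h) M).trans (hw' ▸ hle)
  rw [mul_comm] at this
  exact le_of_mul_le_mul_right this hM'

end Length

/-! ### Finite covolume implies cocompactness in nilpotent groups -/

section Cocompact

/-- By transitivity the translates of `U` cover `X`, and countably many suffice; were `U` null, so
would be `X`. -/
theorem measure_pos_of_smulInvariant {G : Type*} [Group G] {X : Type*} [TopologicalSpace X] [MeasurableSpace X]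
    [BorelSpace X] [SecondCountableTopology X] [MulAction G X] [ContinuousConstSMul G X]
    [MulAction.IsPretransitive G X] (μ : Measure X) [SMulInvariantMeasure G X μ] (hμ : μ ≠ 0)
    {U : Set X} (hU : IsOpen U) (hne : U.Nonempty) : μ U ≠ 0 := by
  intro h0
  apply hμ
  obtain ⟨T, hT, hTU⟩ := TopologicalSpace.isOpen_iUnion_countable
    (fun g : G => (fun x : X => g • x) ⁻¹' U) (fun g => hU.preimage (continuous_const_smul g))
  rw [← Measure.measure_univ_eq_zero]
  have huniv : (⋃ g : G, (fun x : X => g • x) ⁻¹' U) = Set.univ := by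
    obtain ⟨u, hu⟩ := hne
    refine Set.eq_univ_of_forall fun x => ?_
    obtain ⟨g, hg⟩ := MulAction.exists_smul_eq G x u
    exact Set.mem_iUnion.2 ⟨g, by simpa [hg] using hu⟩
  rw [← huniv, ← hTU, measure_biUnion_null_iff hT]
  intro g _
  rw [measure_preimage_smul_of_nullMeasurableSet (hU.measurableSet.nullMeasurableSet), h0]

variable {G : Type*} [Group G] [TopologicalSpace G] [IsTopologicalGroup G]

/-- Here `x` lies in both `a * C * H` and `b * C * H`. Moving elements of `Z` past others costs only
commutators in `H`, so the overlap confines `b`. Contrapositively, elements of `Z` far apart modulo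
`H` give disjoint translates. -/
theorem mem_mul_of_commutator_mem {G : Type*} [Group G] {H Z : Subgroup G}
    (hZ : ∀ z ∈ Z, ∀ g : G, ⁅z, g⁆ ∈ H) {C : Set G} {a b c d x : G} (ha : a ∈ Z) (hb : b ∈ Z)
    (hc : c ∈ C) (hd : d ∈ C) (h1 : c⁻¹ * a⁻¹ * x ∈ H) (h2 : d⁻¹ * b⁻¹ * x ∈ H) :
    b ∈ (H : Set G) * ({a} * (C⁻¹ * C)) := by
  have hk : a⁻¹ * b * c⁻¹ * d ∈ H := by
    have h3 := H.mul_mem (hZ (a⁻¹ * b) (Z.mul_mem (Z.inv_mem ha) hb) c⁻¹)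
      (H.mul_mem h1 (H.inv_mem h2))
    have h4 : ⁅a⁻¹ * b, c⁻¹⁆ * (c⁻¹ * a⁻¹ * x * (d⁻¹ * b⁻¹ * x)⁻¹) = a⁻¹ * b * c⁻¹ * d := by
      rw [commutatorElement_def]; group
    rwa [h4] at h3
  have hk' := H.mul_mem (hZ a ha (a⁻¹ * b * c⁻¹ * d)) hk
  have heq : b = ⁅a, a⁻¹ * b * c⁻¹ * d⁆ * (a⁻¹ * b * c⁻¹ * d) * (a * (d⁻¹ * c)) := by
    rw [commutatorElement_def]; group
  rw [heq]
  exact Set.mul_mem_mul hk' (Set.mul_mem_mul rfl (Set.mul_mem_mul (Set.inv_mem_inv.2 hd) hc))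

/-- Finitely many translates of a compact set absorb a subgroup that normalises a closed
subgroup `H` containing a subgroup of finite covolume. -/
theorem exists_isCompact_subset_mul_of_commutator_mem [LocallyCompactSpace G]
    [SecondCountableTopology G]
    {Γ H Z : Subgroup G} [MeasurableSpace (G ⧸ Γ)] [BorelSpace (G ⧸ Γ)] (μ : Measure (G ⧸ Γ))
    (hμ : μ ≠ 0) [IsFiniteMeasure μ] [SMulInvariantMeasure G (G ⧸ Γ) μ]
    (hΓH : Γ ≤ H) (hZ : ∀ z ∈ Z, ∀ g : G, ⁅z, g⁆ ∈ H) :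
    ∃ K : Set G, IsCompact K ∧ (Z : Set G) ⊆ (H : Set G) * K := by
  obtain ⟨C, hC, hC1⟩ := exists_compact_mem_nhds (1 : G)
  by_contra! hcon
  have hstep : ∀ s : Finset G, (∀ x ∈ s, x ∈ Z) →
      ∃ y, y ∈ Z ∧ ∀ x ∈ s, y ∉ (H : Set G) * ({x} * (C⁻¹ * C)) := by
    intro s _
    have hK : IsCompact (⋃ x ∈ s, ({x} * (C⁻¹ * C) : Set G)) :=
      s.isCompact_biUnion fun x _ => isCompact_singleton.mul (hC.inv.mul hC)
    obtain ⟨y, hy, hy'⟩ := Set.not_subset.1 (hcon _ hK)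
    refine ⟨y, hy, fun x hx hmem => hy' ?_⟩
    obtain ⟨h, hh, w, hw, rfl⟩ := hmem
    exact ⟨h, hh, w, Set.mem_iUnion₂.2 ⟨x, hx, hw⟩, rfl⟩
  -- If no compact set works, infinitely many `z n` can be chosen far apart modulo `H`. The
  -- translates of `U` by them are disjoint with equal positive measure, contradicting finiteness of
  -- `μ`.
  obtain ⟨z, hzZ, hz⟩ := exists_seq_of_forall_finset_exists (fun x => x ∈ Z)
    (fun x y => y ∉ (H : Set G) * ({x} * (C⁻¹ * C))) hstep
  set V : Set G := interior C * (H : Set G) with hV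
  have hVo : IsOpen V := isOpen_interior.mul_right
  set U : Set (G ⧸ Γ) := QuotientGroup.mk '' V with hU
  have hUo : IsOpen U := QuotientGroup.isOpenMap_coe _ hVo
  have hUne : U.Nonempty :=
    ⟨_, 1, ⟨1, mem_interior_iff_mem_nhds.2 hC1, 1, H.one_mem, by simp⟩, rfl⟩
  have hpos := measure_pos_of_smulInvariant (G := G) μ hμ hUo hUne
  let A : ℕ → Set (G ⧸ Γ) := fun n => (fun x => (z n)⁻¹ • x) ⁻¹' U
  have hA : ∀ n, μ (A n) = μ U := fun n =>
    measure_preimage_smul_of_nullMeasurableSet hUo.measurableSet.nullMeasurableSet _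
  have hmem : ∀ n (x : G), (x : G ⧸ Γ) ∈ A n → ∃ c ∈ C, c⁻¹ * (z n)⁻¹ * x ∈ H := by
    rintro n x ⟨v, ⟨c, hc, h, hh, rfl⟩, hv⟩
    have hv' : ((c * h : G) : G ⧸ Γ) = (((z n)⁻¹ * x : G) : G ⧸ Γ) := hv
    rw [QuotientGroup.eq] at hv'
    refine ⟨c, interior_subset hc, ?_⟩
    have := H.mul_mem hh (hΓH hv')
    simpa [mul_assoc] using this
  have hdisj : Pairwise (Function.onFun Disjoint A) := by
    refine (pairwise_disjoint_on A).2 fun m n hmn => Set.disjoint_left.2 ?_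
    intro x hxm hxn
    obtain ⟨x, rfl⟩ := QuotientGroup.mk_surjective x
    obtain ⟨c, hc, h1⟩ := hmem m x hxm
    obtain ⟨d, hd, h2⟩ := hmem n x hxn
    apply hz m n hmn
    exact mem_mul_of_commutator_mem hZ (hzZ m) (hzZ n) hc hd h1 h2
  have htop : μ (⋃ n, A n) = ⊤ := by
    rw [measure_iUnion hdisj fun n => (hUo.preimage (continuous_const_smul _)).measurableSet]
    simp_rw [hA]
    exact ENNReal.tsum_const_eq_top_of_ne_zero hpos
  exact measure_ne_top μ _ htop

/-- A closed subgroup of finite covolume in a nilpotent locally compact group is cocompact. -/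
theorem exists_isCompact_mul_eq_univ [LocallyCompactSpace G] [SecondCountableTopology G]
    [Group.IsNilpotent G] {Γ : Subgroup G} (hc : IsClosed (Γ : Set G))
    [MeasurableSpace (G ⧸ Γ)] [BorelSpace (G ⧸ Γ)] (μ : Measure (G ⧸ Γ))
    (hμ : μ ≠ 0) [IsFiniteMeasure μ] [SMulInvariantMeasure G (G ⧸ Γ) μ] :
    ∃ K : Set G, IsCompact K ∧ ∀ g : G, ∃ c ∈ K, c⁻¹ * g ∈ Γ := by
  -- Climb the upper central series: commutators with its next term fall into the closed subgroup
  -- already controlled. Closures are needed because `Γ` times a term of the series need not be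
  -- closed.
  have key : ∀ i, ∃ K : Set G, IsCompact K ∧
      ((Γ ⊔ Subgroup.upperCentralSeries G i).topologicalClosure : Set G) ⊆ (Γ : Set G) * K := by
    intro i
    induction i with
    | zero =>
      refine ⟨{1}, isCompact_singleton, ?_⟩
      rw [Subgroup.upperCentralSeries_zero, sup_bot_eq, Subgroup.topologicalClosure_coe,
        hc.closure_eq]
      simp
    | succ i ih =>
      obtain ⟨K, hK, hKi⟩ := ih
      set H := (Γ ⊔ Subgroup.upperCentralSeries G i).topologicalClosure with hH
      have hΓH : Γ ≤ H := le_sup_left.trans (Subgroup.le_topologicalClosure _)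
      have hZH : Subgroup.upperCentralSeries G i ≤ H :=
        le_sup_right.trans (Subgroup.le_topologicalClosure _)
      obtain ⟨K', hK', hsub⟩ := exists_isCompact_subset_mul_of_commutator_mem μ hμ hΓH
        (Z := Subgroup.upperCentralSeries G (i + 1))
        fun z hz g => hZH (Subgroup.mem_upperCentralSeries_succ_iff.1 hz g)
      refine ⟨K * K', hK.mul hK', ?_⟩
      rw [← mul_assoc]
      refine Set.Subset.trans ?_ (Set.mul_subset_mul_right hKi)
      rw [Subgroup.topologicalClosure_coe]
      have hcl : IsClosed (H : Set G) := Subgroup.isClosed_topologicalClosure _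
      refine closure_minimal ?_ (hcl.mul_right_of_isCompact hK')
      rw [Subgroup.mul_normal]
      rintro _ ⟨γ, hγ, z, hz, rfl⟩
      obtain ⟨h, hh, k, hk, rfl⟩ := hsub hz
      exact ⟨γ * h, H.mul_mem (hΓH hγ) hh, k, hk, by simp [mul_assoc]⟩
  obtain ⟨n, hn⟩ := ‹Group.IsNilpotent G›
  obtain ⟨K, hK, hsub⟩ := key n
  refine ⟨K⁻¹, hK.inv, fun g => ?_⟩
  have hg : g⁻¹ ∈ ((Γ ⊔ Subgroup.upperCentralSeries G n).topologicalClosure : Set G) := by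
    rw [hn, sup_top_eq]
    exact Subgroup.le_topologicalClosure _ (Subgroup.mem_top _)
  obtain ⟨γ, hγ, k, hk, hkg⟩ := hsub hg
  refine ⟨k⁻¹, Set.inv_mem_inv.2 hk, ?_⟩
  have : k⁻¹⁻¹ * g = γ⁻¹ := by
    have : g = (γ * k)⁻¹ := by rw [← inv_eq_iff_eq_inv]; exact hkg.symm
    rw [this]; group
  rw [this]
  exact Γ.inv_mem hγ

end Cocompact

/-! ### Invariant seminorms and eigenvalues off the unit circle -/

section SeminormEigen

open scoped TensorProduct

variable {V : Type*} [AddCommGroup V] [Module ℝ V]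

/-- A seminorm on a complex space that is invariant under an endomorphism vanishes on the
generalized eigenvectors whose eigenvalue is off the unit circle. -/
theorem Seminorm.eq_zero_of_mem_maxGenEigenspace {W : Type*} [AddCommGroup W] [Module ℂ W]
    (q : Seminorm ℂ W) (B : Module.End ℂ W) (hB : ∀ w, q (B w) = q w) {z : ℂ} (hz : ‖z‖ ≠ 1)
    {w : W} (hw : w ∈ B.maxGenEigenspace z) : q w = 0 := by
  rw [Module.End.mem_maxGenEigenspace] at hw
  obtain ⟨k, hk⟩ := hw
  induction k generalizing w with
  | zero => simp at hk; simp [hk]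
  | succ k ih =>
    -- By induction `q` does not see `(B - z) w`, so `q (B w) = ‖z‖ * q w`; invariance then forces
    -- `q w = 0`.
    have h1 : q ((B - z • 1) w) = 0 := ih (by rwa [pow_succ] at hk)
    have h2 : B w = (B - z • 1) w + z • w := by simp
    have h3 : q (B w) ≤ q (z • w) := by
      rw [h2]; exact (map_add_le_add q _ _).trans (by rw [h1, zero_add])
    have h4 : q (z • w) ≤ q (B w) := by
      have : z • w = B w - (B - z • 1) w := by simp
      rw [this]; exact (map_sub_le_add q _ _).trans (by rw [h1, add_zero])
    have h5 := le_antisymm h3 h4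
    rw [hB, map_smul_eq_mul] at h5
    by_contra h0
    exact hz (mul_right_cancel₀ h0 (by rw [one_mul, ← h5]))

/-- The real part of a vector of the complexification. -/
noncomputable def complexificationRe (V : Type*) [AddCommGroup V] [Module ℝ V] :
    ℂ ⊗[ℝ] V →ₗ[ℝ] V :=
  (TensorProduct.lid ℝ V).toLinearMap ∘ₗ Complex.reLm.rTensor V

@[simp]
theorem complexificationRe_tmul (z : ℂ) (v : V) : complexificationRe V (z ⊗ₜ v) = z.re • v := by
  simp [complexificationRe]

theorem complexificationRe_baseChange (B : V →ₗ[ℝ] V) (w : ℂ ⊗[ℝ] V) :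
    complexificationRe V (B.baseChange ℂ w) = B (complexificationRe V w) := by
  induction w with
  | zero => simp
  | tmul z v => simp
  | add x y hx hy => simp only [map_add, hx, hy]

theorem complexificationRe_smul (z : ℂ) (w : ℂ ⊗[ℝ] V) :
    complexificationRe V (z • w) =
      z.re • complexificationRe V w + z.im • complexificationRe V (Complex.I • w) := by
  induction w with
  | zero => simp
  | tmul x v => simp [TensorProduct.smul_tmul', smul_smul, sub_eq_add_neg, add_smul]
  | add x y hx hy => simp only [map_add, smul_add, hx, hy]; abel

/-- The complex seminorm `w ↦ sup_{‖z‖ = 1} p (Re (z • w))`. -/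
noncomputable def Seminorm.complexification (p : Seminorm ℝ V) : Seminorm ℂ (ℂ ⊗[ℝ] V) :=
  have hbdd : ∀ w : ℂ ⊗[ℝ] V, BddAbove (Set.range fun z : Metric.sphere (0 : ℂ) 1 =>
      p (complexificationRe V ((z : ℂ) • w))) := by
    intro w
    refine ⟨p (complexificationRe V w) + p (complexificationRe V (Complex.I • w)), ?_⟩
    rintro _ ⟨z, rfl⟩
    have hz : ‖(z : ℂ)‖ = 1 := by simp
    simp only
    rw [complexificationRe_smul]
    refine (map_add_le_add p _ _).trans ?_
    rw [map_smul_eq_mul, map_smul_eq_mul]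
    have h1 : ‖(z : ℂ).re‖ ≤ 1 := (Complex.abs_re_le_norm _).trans hz.le
    have h2 : ‖(z : ℂ).im‖ ≤ 1 := (Complex.abs_im_le_norm _).trans hz.le
    have := apply_nonneg p (complexificationRe V w)
    have := apply_nonneg p (complexificationRe V (Complex.I • w))
    nlinarith
  have hne : Nonempty (Metric.sphere (0 : ℂ) 1) := ⟨⟨1, by simp⟩⟩
  Seminorm.ofSMulLE (fun w => ⨆ z : Metric.sphere (0 : ℂ) 1, p (complexificationRe V ((z : ℂ) • w)))
    (by simp)
    (fun v w => ciSup_le fun z => by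
      rw [smul_add, map_add]
      exact (map_add_le_add p _ _).trans (add_le_add (le_ciSup (hbdd v) z) (le_ciSup (hbdd w) z)))
    (fun a w => ciSup_le fun z => by
      have hz : ‖(z : ℂ)‖ = 1 := by simp
      by_cases ha : a = 0
      · simp [ha]
      have ha' : ‖a‖ ≠ 0 := norm_ne_zero_iff.2 ha
      -- The phase of `a` is absorbed into the rotation `z`, leaving the real factor `‖a‖`.
      let z' : Metric.sphere (0 : ℂ) 1 := ⟨z * a / ‖a‖, by simp [hz, ha']⟩
      have : (z : ℂ) • a • w = (‖a‖ : ℂ) • ((z' : ℂ) • w) := by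
        rw [smul_smul, smul_smul]
        congr 1
        have : (‖a‖ : ℂ) ≠ 0 := by exact_mod_cast ha'
        simp only [z']
        field_simp
      rw [this, complexificationRe_smul, Complex.ofReal_re, Complex.ofReal_im, zero_smul, add_zero,
        map_smul_eq_mul, norm_norm]
      exact mul_le_mul_of_nonneg_left (le_ciSup (hbdd w) z') (norm_nonneg _))

theorem Seminorm.complexification_apply (p : Seminorm ℝ V) (w : ℂ ⊗[ℝ] V) :
    p.complexification w =
      ⨆ z : Metric.sphere (0 : ℂ) 1, p (complexificationRe V ((z : ℂ) • w)) := rfl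

theorem Seminorm.le_complexification (p : Seminorm ℝ V) (v : V) :
    p v ≤ p.complexification (1 ⊗ₜ v) := by
  rw [Seminorm.complexification_apply]
  refine le_trans ?_ (le_ciSup (f := fun z : Metric.sphere (0 : ℂ) 1 =>
    p (complexificationRe V ((z : ℂ) • (1 ⊗ₜ v)))) ⟨p v, ?_⟩ ⟨1, by simp⟩)
  · simp
  · rintro _ ⟨z, rfl⟩
    have hz : ‖(z : ℂ)‖ = 1 := by simp
    have h1 : ‖(z : ℂ).re‖ ≤ 1 := (Complex.abs_re_le_norm _).trans hz.le
    simp only [TensorProduct.smul_tmul', smul_eq_mul, mul_one, complexificationRe_tmul,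
      map_smul_eq_mul]
    exact mul_le_of_le_one_left (apply_nonneg p v) h1

/-- A seminorm on a finite-dimensional space that is invariant under an endomorphism without
eigenvalues on the unit circle is zero. -/
theorem Seminorm.eq_zero_of_noEigenvalueOnUnitCircle [FiniteDimensional ℝ V] (p : Seminorm ℝ V)
    {B : V →ₗ[ℝ] V} (hB : NoEigenvalueOnUnitCircle B) (hp : ∀ v, p (B v) = p v) (v : V) :
    p v = 0 := by
  have hinv : ∀ w, p.complexification (B.baseChange ℂ w) = p.complexification w := by
    intro w
    simp only [Seminorm.complexification_apply, ← map_smul, complexificationRe_baseChange, hp]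
  have hzero : ∀ w : ℂ ⊗[ℝ] V, p.complexification w = 0 := by
    intro w
    have hw : w ∈ ⨆ z : ℂ, Module.End.maxGenEigenspace (B.baseChange ℂ) z := by
      rw [Module.End.iSup_maxGenEigenspace_eq_top]; trivial
    induction hw using Submodule.iSup_induction' with
    | mem z x hx =>
      by_cases hz : Module.End.HasEigenvalue (B.baseChange ℂ) z
      · exact p.complexification.eq_zero_of_mem_maxGenEigenspace _ hinv (hB z hz) hx
      · have : Module.End.maxGenEigenspace (B.baseChange ℂ) z = ⊥ := by
          by_contra hne
          exact hz ((show Module.End.HasUnifEigenvalue (B.baseChange ℂ) z ⊤ from hne).lt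
            zero_lt_one)
        rw [this, Submodule.mem_bot] at hx
        simp [hx]
    | zero => simp
    | add x y _ _ hx hy =>
      exact le_antisymm ((map_add_le_add _ x y).trans (by rw [hx, hy, add_zero]))
        (apply_nonneg _ _)
  exact le_antisymm ((p.le_complexification v).trans (hzero _).le) (apply_nonneg p v)

end SeminormEigen

/-! ### Growth rates at the origin and local vanishing -/

section DirectionalGrowth

variable {E : Type*} [NormedAddCommGroup E] [NormedSpace ℝ E]

/-- The upper growth rate of `f` at the origin in the direction `v`. -/
noncomputable def directionalGrowth (f : E → ℝ) (v : E) : ℝ :=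
  sInf {c | 0 ≤ c ∧ ∀ᶠ t in 𝓝[>] (0 : ℝ), f (t • v) ≤ c * t}

/-- `f` is Lipschitz near the origin, with value `0` there. -/
def IsLipschitzAtZero (f : E → ℝ) (C : ℝ) : Prop :=
  f 0 = 0 ∧ 0 < C ∧ ∀ᶠ z in 𝓝 (0 : E × E), f z.1 ≤ f z.2 + C * ‖z.1 - z.2‖

variable {f : E → ℝ} {C : ℝ}

theorem directionalGrowth_le {v : E} {c : ℝ} (hc : 0 ≤ c)
    (h : ∀ᶠ t in 𝓝[>] (0 : ℝ), f (t • v) ≤ c * t) : directionalGrowth f v ≤ c :=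
  csInf_le ⟨0, fun _ h => h.1⟩ ⟨hc, h⟩

theorem directionalGrowth_nonneg (v : E) : 0 ≤ directionalGrowth f v :=
  Real.sInf_nonneg fun _ h => h.1

theorem tendsto_smul_nhdsGT_zero (v : E) :
    Tendsto (fun t : ℝ => t • v) (𝓝[>] 0) (𝓝 0) := by
  have : Tendsto (fun t : ℝ => t • v) (𝓝 0) (𝓝 ((0 : ℝ) • v)) :=
    (continuous_id.smul continuous_const).tendsto 0
  rw [zero_smul] at this
  exact this.mono_left nhdsWithin_le_nhds

theorem IsLipschitzAtZero.eventually_le (hf : IsLipschitzAtZero f C) {v : E} {c : ℝ}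
    (h : directionalGrowth f v < c) : ∀ᶠ t in 𝓝[>] (0 : ℝ), f (t • v) ≤ c * t := by
  -- The Lipschitz bound supplies an admissible slope; on an empty set `sInf` would be the
  -- meaningless value `0`.
  have hne : {c | 0 ≤ c ∧ ∀ᶠ t in 𝓝[>] (0 : ℝ), f (t • v) ≤ c * t}.Nonempty := by
    refine ⟨C * ‖v‖, mul_nonneg hf.2.1.le (norm_nonneg v), ?_⟩
    have h1 : Tendsto (fun t : ℝ => (t • v, (0 : E))) (𝓝[>] 0) (𝓝 0) :=
      (tendsto_smul_nhdsGT_zero v).prodMk_nhds tendsto_const_nhds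
    filter_upwards [h1.eventually hf.2.2, self_mem_nhdsWithin] with t ht ht0
    simp only [hf.1, sub_zero, zero_add, norm_smul, Real.norm_eq_abs, abs_of_pos ht0.out] at ht
    linarith
  obtain ⟨d, hd, hdc⟩ := exists_lt_of_csInf_lt hne h
  filter_upwards [hd.2, self_mem_nhdsWithin] with t ht ht0
  exact ht.trans (mul_le_mul_of_nonneg_right hdc.le ht0.out.le)

omit [NormedSpace ℝ E] in
-- Since `f` is Lipschitz, tangent curves have the same growth rate. Rays can therefore be replaced
-- by the curves produced by group multiplication or by an automorphism in a chart.
theorem IsLipschitzAtZero.eventually_le_of_isLittleO (hf : IsLipschitzAtZero f C) {u w : ℝ → E}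
    (hu : Tendsto u (𝓝[>] 0) (𝓝 0)) (hw : Tendsto w (𝓝[>] 0) (𝓝 0))
    (huw : (fun t => w t - u t) =o[𝓝[>] 0] (fun t : ℝ => t)) {c ε : ℝ} (hε : 0 < ε)
    (h : ∀ᶠ t in 𝓝[>] (0 : ℝ), f (u t) ≤ c * t) :
    ∀ᶠ t in 𝓝[>] (0 : ℝ), f (w t) ≤ (c + ε) * t := by
  filter_upwards [(hw.prodMk_nhds hu).eventually hf.2.2, h, self_mem_nhdsWithin,
    huw.def (div_pos hε hf.2.1)] with t h1 h2 ht h3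
  rw [Real.norm_eq_abs, abs_of_pos ht.out, div_mul_eq_mul_div, le_div_iff₀ hf.2.1] at h3
  linarith

theorem isLittleO_smul_of_hasDerivAt {u : ℝ → E} {v : E} (hu0 : u 0 = 0) (hu : HasDerivAt u v 0) :
    (fun t => u t - t • v) =o[𝓝[>] 0] (fun t : ℝ => t) := by
  have := hasDerivAt_iff_isLittleO.1 hu
  simp only [hu0, sub_zero] at this
  exact this.mono nhdsWithin_le_nhds

theorem IsLipschitzAtZero.directionalGrowth_le_of_hasDerivAt (hf : IsLipschitzAtZero f C)
    {u : ℝ → E} {v : E} (hu0 : u 0 = 0) (hu : HasDerivAt u v 0) {c : ℝ} (hc : 0 ≤ c)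
    (h : ∀ᶠ t in 𝓝[>] (0 : ℝ), f (u t) ≤ c * t) : directionalGrowth f v ≤ c := by
  refine le_of_forall_pos_le_add fun ε hε => directionalGrowth_le (by linarith) ?_
  have h0 : Tendsto u (𝓝[>] 0) (𝓝 0) := by
    have := hu.continuousAt.tendsto
    rw [hu0] at this
    exact this.mono_left nhdsWithin_le_nhds
  refine hf.eventually_le_of_isLittleO h0 (tendsto_smul_nhdsGT_zero v) ?_ hε h
  simpa using (isLittleO_smul_of_hasDerivAt hu0 hu).neg_left

theorem IsLipschitzAtZero.eventually_le_of_hasDerivAt (hf : IsLipschitzAtZero f C)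
    {u : ℝ → E} {v : E} (hu0 : u 0 = 0) (hu : HasDerivAt u v 0) {c : ℝ}
    (h : directionalGrowth f v < c) : ∀ᶠ t in 𝓝[>] (0 : ℝ), f (u t) ≤ c * t := by
  have h0 : Tendsto u (𝓝[>] 0) (𝓝 0) := by
    have := hu.continuousAt.tendsto
    rw [hu0] at this
    exact this.mono_left nhdsWithin_le_nhds
  obtain ⟨d, hd, hdc⟩ := exists_between h
  have := hf.eventually_le_of_isLittleO (tendsto_smul_nhdsGT_zero v) h0
    (isLittleO_smul_of_hasDerivAt hu0 hu) (sub_pos.2 hdc) (hf.eventually_le hd)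
  simpa using this

theorem IsLipschitzAtZero.directionalGrowth_zero (hf : IsLipschitzAtZero f C) :
    directionalGrowth f (0 : E) = 0 :=
  le_antisymm (directionalGrowth_le le_rfl (by simp [hf.1])) (directionalGrowth_nonneg _)

theorem IsLipschitzAtZero.directionalGrowth_smul_le (hf : IsLipschitzAtZero f C) {s : ℝ}
    (hs : 0 < s) (v : E) : directionalGrowth f (s • v) ≤ s * directionalGrowth f v := by
  rw [mul_comm, ← div_le_iff₀ hs]
  refine le_of_forall_gt_imp_ge_of_dense fun c hc => ?_
  rw [div_le_iff₀ hs]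
  refine directionalGrowth_le (mul_nonneg ((directionalGrowth_nonneg v).trans hc.le) hs.le) ?_
  have h1 : Tendsto (fun t : ℝ => t * s) (𝓝[>] 0) (𝓝[>] 0) := by
    refine tendsto_nhdsWithin_iff.2 ⟨?_, ?_⟩
    · have : Tendsto (fun t : ℝ => t * s) (𝓝 0) (𝓝 (0 * s)) :=
        (continuous_id.mul continuous_const).tendsto 0
      rw [zero_mul] at this
      exact this.mono_left nhdsWithin_le_nhds
    · filter_upwards [self_mem_nhdsWithin] with t ht
      exact mul_pos ht.out hs
  filter_upwards [h1.eventually (hf.eventually_le hc)] with t ht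
  rw [smul_smul]
  linarith

/-- The directional growth is a seminorm if `f` is subadditive along a map that is tangent to the
difference. -/
noncomputable def IsLipschitzAtZero.growthSeminorm (hf : IsLipschitzAtZero f C)
    (q : E × E → E) (hq0 : q 0 = 0)
    (hq : HasFDerivAt q (ContinuousLinearMap.snd ℝ E E - ContinuousLinearMap.fst ℝ E E) 0)
    (hfq : ∀ᶠ z in 𝓝 (0 : E × E), f (q z) ≤ f z.1 + f z.2) : Seminorm ℝ E :=
  have hsub : ∀ x y, directionalGrowth f (y - x) ≤
      directionalGrowth f x + directionalGrowth f y := by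
    intro x y
    refine le_of_forall_pos_le_add fun ε hε => ?_
    have hx := hf.eventually_le (lt_add_of_pos_right (directionalGrowth f x) (half_pos hε))
    have hy := hf.eventually_le (lt_add_of_pos_right (directionalGrowth f y) (half_pos hε))
    have hline : HasDerivAt (fun t : ℝ => t • (x, y)) (x, y) 0 := by
      simpa using (hasDerivAt_id (0 : ℝ)).smul_const (x, y)
    have hderiv : HasDerivAt (fun t : ℝ => q (t • (x, y))) (y - x) 0 := by
      have hq' : HasFDerivAt q
          (ContinuousLinearMap.snd ℝ E E - ContinuousLinearMap.fst ℝ E E) ((0 : ℝ) • (x, y)) := by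
        rwa [zero_smul]
      have h := hq'.comp_hasDerivAt (0 : ℝ) hline
      exact h
    refine hf.directionalGrowth_le_of_hasDerivAt (by simp [hq0]) hderiv ?_ ?_
    · have := directionalGrowth_nonneg (f := f) x
      have := directionalGrowth_nonneg (f := f) y
      linarith
    · filter_upwards [hx, hy, (tendsto_smul_nhdsGT_zero (x, y)).eventually hfq] with t h1 h2 h3
      simp only [Prod.smul_mk] at h3 ⊢
      linarith
  have hneg : ∀ x, directionalGrowth f (-x) ≤ directionalGrowth f x := fun x => by
    simpa [hf.directionalGrowth_zero] using hsub x 0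
  Seminorm.ofSMulLE (directionalGrowth f) hf.directionalGrowth_zero
    (fun x y => by
      have h1 := hsub (-x) y
      have h2 := hneg x
      rw [sub_neg_eq_add, add_comm y x] at h1
      linarith)
    (fun s v => by
      rcases lt_trichotomy s 0 with hs | rfl | hs
      · have h1 := hf.directionalGrowth_smul_le (neg_pos.2 hs) (-v)
        rw [smul_neg, neg_smul, neg_neg] at h1
        rw [Real.norm_eq_abs, abs_of_neg hs]
        exact h1.trans (mul_le_mul_of_nonneg_left (hneg v) (neg_pos.2 hs).le)
      · simp [hf.directionalGrowth_zero]
      · rw [Real.norm_eq_abs, abs_of_pos hs]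
        exact hf.directionalGrowth_smul_le hs v)

theorem IsLipschitzAtZero.directionalGrowth_map (hf : IsLipschitzAtZero f C) {b : E → E}
    {B : E →L[ℝ] E} (hb0 : b 0 = 0) (hb : HasFDerivAt b B 0)
    (hfb : ∀ᶠ x in 𝓝 (0 : E), f (b x) = f x) (v : E) :
    directionalGrowth f (B v) = directionalGrowth f v := by
  have hline : HasDerivAt (fun t : ℝ => t • v) v 0 := by
    simpa using (hasDerivAt_id (0 : ℝ)).smul_const v
  have hderiv : HasDerivAt (fun t : ℝ => b (t • v)) (B v) 0 := by
    have hb' : HasFDerivAt b B ((0 : ℝ) • v) := by rwa [zero_smul]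
    exact hb'.comp_hasDerivAt (0 : ℝ) hline
  have hu0 : b ((0 : ℝ) • v) = 0 := by rw [zero_smul, hb0]
  have hev := (tendsto_smul_nhdsGT_zero v).eventually hfb
  refine le_antisymm ?_ ?_
  · refine le_of_forall_gt_imp_ge_of_dense fun c hc =>
      hf.directionalGrowth_le_of_hasDerivAt (u := fun t : ℝ => b (t • v)) hu0 hderiv
        ((directionalGrowth_nonneg v).trans hc.le) ?_
    filter_upwards [hev, hf.eventually_le hc] with t h1 h2
    rwa [h1]
  · refine le_of_forall_gt_imp_ge_of_dense fun c hc =>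
      directionalGrowth_le ((directionalGrowth_nonneg _).trans hc.le) ?_
    filter_upwards [hev, hf.eventually_le_of_hasDerivAt (u := fun t : ℝ => b (t • v)) hu0 hderiv hc]
      with t h1 h2
    rwa [h1] at h2

/-- The estimate for one direction extends to nearby directions by the Lipschitz bound; compactness
of the unit sphere makes it uniform. -/
theorem IsLipschitzAtZero.eventually_le_norm [FiniteDimensional ℝ E] (hf : IsLipschitzAtZero f C)
    (h0 : ∀ v, directionalGrowth f v = 0) {ε : ℝ} (hε : 0 < ε) :
    ∀ᶠ x in 𝓝 (0 : E), f x ≤ ε * ‖x‖ := by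
  have hK : IsCompact (Metric.sphere (0 : E) 1) := isCompact_sphere 0 1
  have key : ∀ᶠ t in 𝓝 (0 : ℝ), ∀ v ∈ Metric.sphere (0 : E) 1, 0 < t → f (t • v) ≤ ε * t := by
    refine hK.eventually_forall_of_forall_eventually fun v _ => ?_
    have h1 := hf.eventually_le (v := v) (c := ε / 2) (by rw [h0]; linarith)
    rw [eventually_nhdsWithin_iff] at h1
    have h2 : Tendsto (fun z : ℝ × E => (z.1 • z.2, z.1 • v)) (𝓝 (0, v)) (𝓝 0) := by
      have : Continuous (fun z : ℝ × E => (z.1 • z.2, z.1 • v)) := by fun_prop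
      simpa [Prod.mk_zero_zero] using this.tendsto (0, v)
    have h3 : ∀ᶠ z : ℝ × E in 𝓝 (0, v), ‖z.2 - v‖ < ε / (2 * C) := by
      have : Continuous (fun z : ℝ × E => ‖z.2 - v‖) := by fun_prop
      have h := this.tendsto (0, v)
      simp only [sub_self, norm_zero] at h
      have hC := hf.2.1
      exact h.eventually (gt_mem_nhds (by positivity))
    filter_upwards [h2.eventually hf.2.2, continuousAt_fst.eventually h1, h3] with z hz1 hz2 hz3 hz0
    have h4 := hz2 hz0
    simp only [← smul_sub, norm_smul, Real.norm_eq_abs, abs_of_pos hz0] at hz1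
    rw [lt_div_iff₀ (by linarith [hf.2.1])] at hz3
    nlinarith
  have hnorm : Tendsto (fun x : E => ‖x‖) (𝓝 0) (𝓝 0) := by
    simpa using (continuous_norm (E := E)).tendsto 0
  filter_upwards [hnorm.eventually key] with x hx
  by_cases hx0 : x = 0
  · simp [hx0, hf.1]
  · have hx1 : 0 < ‖x‖ := norm_pos_iff.2 hx0
    have := hx (‖x‖⁻¹ • x) (by simp [norm_smul, hx1.ne']) hx1
    rwa [smul_inv_smul₀ hx1.ne'] at this

/-- A local length function that is invariant under a map whose derivative has no eigenvalue on
the unit circle vanishes near the origin. The maps `q` and `b` play the roles of `(x, y) ↦ x⁻¹ y`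
and of an automorphism in local coordinates. -/
theorem eventually_eq_zero_of_noEigenvalueOnUnitCircle [FiniteDimensional ℝ E]
    (hf0 : f 0 = 0) {K : ℝ} (hfK : ∀ᶠ x in 𝓝 (0 : E), f x ≤ K * ‖x‖)
    {q : E × E → E} (hqq : ∀ x, q (x, x) = 0)
    (hq : HasStrictFDerivAt q (ContinuousLinearMap.snd ℝ E E - ContinuousLinearMap.fst ℝ E E) 0)
    (hfq : ∀ᶠ z in 𝓝 (0 : E × E), f (q z) ≤ f z.1 + f z.2 ∧ f z.1 ≤ f z.2 + f (q z) ∧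
      f z.2 ≤ f z.1 + f (q z))
    {b : E → E} {B : E →L[ℝ] E} (hb0 : b 0 = 0) (hb : HasFDerivAt b B 0)
    (hfb : ∀ᶠ x in 𝓝 (0 : E), f (b x) = f x)
    (hB : NoEigenvalueOnUnitCircle (B : E →ₗ[ℝ] E)) : ∀ᶠ x in 𝓝 (0 : E), f x = 0 := by
  have hq0 : q 0 = 0 := hqq 0
  -- Strict differentiability compares `z` with the diagonal point `(z.1, z.1)`, where `q` vanishes.
  have hq2 : ∀ᶠ z in 𝓝 (0 : E × E), ‖q z‖ ≤ 2 * ‖z.1 - z.2‖ := by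
    have h1 := hq.isLittleO.def (show (0 : ℝ) < 1 by norm_num)
    have h2 : Tendsto (fun z : E × E => (z, (z.1, z.1))) (𝓝 0) (𝓝 (0, (0, 0))) := by
      have : Continuous (fun z : E × E => (z, (z.1, z.1))) := by fun_prop
      simpa only [Prod.fst_zero] using this.tendsto 0
    filter_upwards [h2.eventually h1] with z hz
    simp only [hqq, sub_zero, one_mul] at hz
    have h3 : z - (z.1, z.1) = (0, z.2 - z.1) := by ext <;> simp
    rw [h3] at hz
    simp only [sub_apply, ContinuousLinearMap.coe_snd',
      ContinuousLinearMap.coe_fst', sub_zero, Prod.norm_mk, norm_zero] at hz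
    rw [max_eq_right (norm_nonneg _)] at hz
    have h4 := norm_le_norm_add_norm_sub' (q z) (z.2 - z.1)
    rw [norm_sub_rev z.1 z.2]
    linarith
  have hqt : Tendsto q (𝓝 0) (𝓝 0) := by simpa [hq0] using hq.continuousAt.tendsto
  have hlip : IsLipschitzAtZero f (2 * max K 1) := by
    have hK1 : 0 < max K 1 := lt_max_of_lt_right one_pos
    refine ⟨hf0, by linarith, ?_⟩
    filter_upwards [hfq, hq2, hqt.eventually hfK] with z h1 h2 h3
    have h4 : K * ‖q z‖ ≤ max K 1 * ‖q z‖ :=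
      mul_le_mul_of_nonneg_right (le_max_left _ _) (norm_nonneg _)
    have h5 := mul_le_mul_of_nonneg_left h2 hK1.le
    linarith [h1.2.1]
  let p := hlip.growthSeminorm q hq0 hq.hasFDerivAt (hfq.mono fun z hz => hz.1)
  have hp : ∀ v, directionalGrowth f v = 0 := fun v =>
    p.eq_zero_of_noEigenvalueOnUnitCircle hB (fun v => hlip.directionalGrowth_map hb0 hb hfb v) v
  obtain ⟨r, hr, hball⟩ := Metric.eventually_nhds_iff_ball.1 (hfq.and hq2)
  have hmem : ∀ x ∈ Metric.ball (0 : E) r, ∀ y ∈ Metric.ball (0 : E) r,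
      (x, y) ∈ Metric.ball (0 : E × E) r := by
    intro x hx y hy
    rw [mem_ball_zero_iff] at hx hy ⊢
    exact max_lt hx hy
  -- The estimate at the origin is carried to `x` by `q`: `|f y - f x| ≤ f (q (x, y)) = o(‖y - x‖)`.
  have hderiv : ∀ x ∈ Metric.ball (0 : E) r, HasFDerivAt f (0 : E →L[ℝ] ℝ) x := by
    intro x hx
    rw [hasFDerivAt_iff_isLittleO]
    refine Asymptotics.IsLittleO.of_bound fun ε hε => ?_
    have h1 := hlip.eventually_le_norm hp (half_pos hε)
    have hcont : Tendsto (fun y => q (x, y)) (𝓝 x) (𝓝 0) := by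
      rw [tendsto_zero_iff_norm_tendsto_zero]
      have hsq : Tendsto (fun y => 2 * ‖x - y‖) (𝓝 x) (𝓝 0) := by
        have : Continuous (fun y : E => 2 * ‖x - y‖) := by fun_prop
        simpa using this.tendsto x
      refine squeeze_zero' (Eventually.of_forall fun y => norm_nonneg _) ?_ hsq
      filter_upwards [Metric.isOpen_ball.mem_nhds hx] with y hy
      exact (hball _ (hmem x hx y hy)).2
    filter_upwards [Metric.isOpen_ball.mem_nhds hx, hcont.eventually h1] with y hy hy1
    obtain ⟨⟨-, h2, h3⟩, h4⟩ := hball _ (hmem x hx y hy)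
    simp only at h2 h3 h4
    rw [norm_sub_rev x y] at h4
    have h5 : ε / 2 * ‖q (x, y)‖ ≤ ε * ‖y - x‖ := by nlinarith
    simp only [zero_apply, sub_zero, Real.norm_eq_abs]
    rw [abs_le]
    constructor <;> linarith
  filter_upwards [Metric.ball_mem_nhds (0 : E) hr] with x hx
  have := (convex_ball (0 : E) r).is_const_of_fderivWithin_eq_zero (𝕜 := ℝ) (f := f)
    (fun y hy => (hderiv y hy).differentiableAt.differentiableWithinAt)
    (fun y hy => by
      rw [fderivWithin_of_isOpen Metric.isOpen_ball hy]; exact (hderiv y hy).fderiv)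
    hx (Metric.mem_ball_self hr)
  rw [this, hf0]

end DirectionalGrowth

/-! ### The group law and automorphisms in a chart at the identity -/

section Chart

variable {E : Type*} [NormedAddCommGroup E] [NormedSpace ℝ E]

/-- A linear map on `E × E` is determined by its values on the diagonal and on the second factor. -/
theorem eq_snd_sub_fst_of_hasFDerivAt {q : E × E → E} {q' : E × E →L[ℝ] E}
    (hq : HasFDerivAt q q' 0) (hqq : ∀ x, q (x, x) = 0) (hq0 : ∀ᶠ y in 𝓝 (0 : E), q (0, y) = y) :
    q' = ContinuousLinearMap.snd ℝ E E - ContinuousLinearMap.fst ℝ E E := by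
  have h1 : ∀ x, q' (x, x) = 0 := by
    intro x
    have h := HasFDerivAt.comp (0 : E) (f := fun x : E => (x, x)) (g := q) (g' := q')
      (f' := (ContinuousLinearMap.id ℝ E).prod (ContinuousLinearMap.id ℝ E)) hq
      ((hasFDerivAt_id (0 : E)).prodMk (hasFDerivAt_id (0 : E)))
    have h0 : q ∘ (fun x : E => (x, x)) = fun _ => (0 : E) := funext hqq
    rw [h0] at h
    have := h.unique (hasFDerivAt_const (0 : E) (0 : E))
    exact DFunLike.congr_fun this x
  have h2 : ∀ y, q' (0, y) = y := by
    intro y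
    have h := HasFDerivAt.comp (0 : E) (f := fun y : E => ((0 : E), y)) (g := q) (g' := q')
      (f' := (0 : E →L[ℝ] E).prod (ContinuousLinearMap.id ℝ E)) hq
      ((hasFDerivAt_const (0 : E) (0 : E)).prodMk (hasFDerivAt_id (0 : E)))
    have h0 : q ∘ (fun y : E => ((0 : E), y)) =ᶠ[𝓝 0] id := hq0
    have := (h.congr_of_eventuallyEq h0.symm).unique (hasFDerivAt_id (0 : E))
    exact DFunLike.congr_fun this y
  ext z
  · have h3 := h1 z
    have h4 := h2 z
    have h5 : q' (z, z) = q' (z, 0) + q' (0, z) := by rw [← map_add]; simp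
    rw [h1, h2] at h5
    simpa using eq_neg_of_add_eq_zero_left h5.symm
  · simp [h2]

variable {N : Type*} [TopologicalSpace N] [ChartedSpace E N] [Group N]

variable (E N) in
/-- The preferred chart at the identity, centred at the origin. -/
noncomputable def identityChart (g : N) : E :=
  extChartAt 𝓘(ℝ, E) (1 : N) g - extChartAt 𝓘(ℝ, E) (1 : N) 1

variable (E N) in
/-- The inverse of the centred chart at the identity. -/
noncomputable def identityChartSymm (v : E) : N :=
  (extChartAt 𝓘(ℝ, E) (1 : N)).symm (extChartAt 𝓘(ℝ, E) (1 : N) 1 + v)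

@[simp]
theorem identityChart_one : identityChart E N 1 = 0 := sub_self _

@[simp]
theorem identityChartSymm_zero : identityChartSymm E N 0 = 1 := by
  simp [identityChartSymm]

theorem eventually_identityChartSymm_identityChart :
    ∀ᶠ g in 𝓝 (1 : N), identityChartSymm E N (identityChart E N g) = g := by
  filter_upwards [extChartAt_source_mem_nhds (I := 𝓘(ℝ, E)) (1 : N)] with g hg
  rw [identityChartSymm, identityChart, add_sub_cancel, (extChartAt 𝓘(ℝ, E) (1 : N)).left_inv hg]

omit [NormedSpace ℝ E] in
theorem tendsto_const_add_nhds_zero (p : E) : Tendsto (fun v : E => p + v) (𝓝 0) (𝓝 p) := by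
  have : Continuous fun v : E => p + v := by fun_prop
  simpa using this.tendsto 0

theorem eventually_identityChart_identityChartSymm :
    ∀ᶠ v in 𝓝 (0 : E), identityChart E N (identityChartSymm E N v) = v := by
  filter_upwards [(tendsto_const_add_nhds_zero _).eventually
    (extChartAt_target_mem_nhds (I := 𝓘(ℝ, E)) (1 : N))] with v hv
  rw [identityChartSymm, identityChart, (extChartAt 𝓘(ℝ, E) (1 : N)).right_inv hv,
    add_sub_cancel_left]

section Smooth

variable [LieGroup 𝓘(ℝ, E) ∞ N]

theorem contMDiffAt_identityChart : ContMDiffAt 𝓘(ℝ, E) 𝓘(ℝ, E) ∞ (identityChart E N) 1 := by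
  have : IsManifold 𝓘(ℝ, E) ∞ N := inferInstance
  exact contMDiffAt_extChartAt.sub contMDiffAt_const

theorem contMDiffAt_identityChartSymm :
    ContMDiffAt 𝓘(ℝ, E) 𝓘(ℝ, E) ∞ (identityChartSymm E N) 0 := by
  have h := (contMDiffOn_extChartAt_symm (I := 𝓘(ℝ, E)) (n := ∞) (1 : N)).contMDiffAt
    (extChartAt_target_mem_nhds (I := 𝓘(ℝ, E)) (1 : N))
  have h2 : ContMDiffAt 𝓘(ℝ, E) 𝓘(ℝ, E) ∞
      (fun v : E => extChartAt 𝓘(ℝ, E) (1 : N) 1 + v) 0 :=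
    (contDiff_const.add contDiff_id).contDiffAt.contMDiffAt
  refine ContMDiffAt.comp (0 : E) ?_ h2
  rwa [add_zero]

theorem tendsto_identityChartSymm : Tendsto (identityChartSymm E N) (𝓝 0) (𝓝 1) := by
  simpa using (contMDiffAt_identityChartSymm (E := E) (N := N)).continuousAt.tendsto

theorem tendsto_identityChart : Tendsto (identityChart E N) (𝓝 1) (𝓝 0) := by
  simpa using (contMDiffAt_identityChart (E := E) (N := N)).continuousAt.tendsto

theorem contMDiffAt_identityChartSymm_fst : ContMDiffAt 𝓘(ℝ, E × E) 𝓘(ℝ, E) ∞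
    (fun z : E × E => identityChartSymm E N z.1) 0 :=
  ContMDiffAt.comp (0 : E × E) (g := identityChartSymm E N) (f := Prod.fst)
    (I' := 𝓘(ℝ, E)) contMDiffAt_identityChartSymm contDiff_fst.contDiffAt.contMDiffAt

theorem contMDiffAt_identityChartSymm_snd : ContMDiffAt 𝓘(ℝ, E × E) 𝓘(ℝ, E) ∞
    (fun z : E × E => identityChartSymm E N z.2) 0 :=
  ContMDiffAt.comp (0 : E × E) (g := identityChartSymm E N) (f := Prod.snd)
    (I' := 𝓘(ℝ, E)) contMDiffAt_identityChartSymm contDiff_snd.contDiffAt.contMDiffAt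

variable (E N) in
/-- Multiplication in the centred chart. -/
noncomputable def chartMul (z : E × E) : E :=
  identityChart E N (identityChartSymm E N z.1 * identityChartSymm E N z.2)

variable (E N) in
/-- Left division `(x, y) ↦ x⁻¹ y` in the centred chart. -/
noncomputable def chartLeftDiv (z : E × E) : E :=
  identityChart E N ((identityChartSymm E N z.1)⁻¹ * identityChartSymm E N z.2)

theorem contMDiffAt_mul_identityChartSymm : ContMDiffAt 𝓘(ℝ, E × E) 𝓘(ℝ, E) ∞
    (fun z : E × E => identityChartSymm E N z.1 * identityChartSymm E N z.2) 0 :=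
  contMDiffAt_identityChartSymm_fst.mul contMDiffAt_identityChartSymm_snd

theorem contMDiffAt_inv_mul_identityChartSymm : ContMDiffAt 𝓘(ℝ, E × E) 𝓘(ℝ, E) ∞
    (fun z : E × E => (identityChartSymm E N z.1)⁻¹ * identityChartSymm E N z.2) 0 :=
  contMDiffAt_identityChartSymm_fst.inv.mul contMDiffAt_identityChartSymm_snd

theorem contDiffAt_chartMul : ContDiffAt ℝ ∞ (chartMul E N) 0 := by
  rw [← contMDiffAt_iff_contDiffAt]
  refine ContMDiffAt.comp (0 : E × E) (I' := 𝓘(ℝ, E)) (g := identityChart E N) ?_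
    contMDiffAt_mul_identityChartSymm
  simpa using contMDiffAt_identityChart

theorem contDiffAt_chartLeftDiv : ContDiffAt ℝ ∞ (chartLeftDiv E N) 0 := by
  rw [← contMDiffAt_iff_contDiffAt]
  refine ContMDiffAt.comp (0 : E × E) (I' := 𝓘(ℝ, E)) (g := identityChart E N) ?_
    contMDiffAt_inv_mul_identityChartSymm
  simpa using contMDiffAt_identityChart

theorem eventually_identityChartSymm_chartMul : ∀ᶠ z in 𝓝 (0 : E × E),
    identityChartSymm E N (chartMul E N z) =
      identityChartSymm E N z.1 * identityChartSymm E N z.2 := by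
  have h := (contMDiffAt_mul_identityChartSymm (E := E) (N := N)).continuousAt.tendsto
  simp only [Prod.fst_zero, Prod.snd_zero, identityChartSymm_zero, mul_one] at h
  exact h.eventually eventually_identityChartSymm_identityChart

theorem eventually_identityChartSymm_chartLeftDiv : ∀ᶠ z in 𝓝 (0 : E × E),
    identityChartSymm E N (chartLeftDiv E N z) =
      (identityChartSymm E N z.1)⁻¹ * identityChartSymm E N z.2 := by
  have h := (contMDiffAt_inv_mul_identityChartSymm (E := E) (N := N)).continuousAt.tendsto
  simp only [Prod.fst_zero, Prod.snd_zero, identityChartSymm_zero, mul_one, inv_one] at h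
  exact h.eventually eventually_identityChartSymm_identityChart

theorem hasStrictFDerivAt_chartLeftDiv : HasStrictFDerivAt (chartLeftDiv E N)
    (ContinuousLinearMap.snd ℝ E E - ContinuousLinearMap.fst ℝ E E) 0 := by
  have h := (contDiffAt_chartLeftDiv (E := E) (N := N)).hasStrictFDerivAt (by simp)
  rwa [eq_snd_sub_fst_of_hasFDerivAt h.hasFDerivAt (fun x => by simp [chartLeftDiv])
    (by simpa [chartLeftDiv] using eventually_identityChart_identityChartSymm)] at h

/-- The coefficient of `‖z.1‖` is exactly `1`, so repeated right multiplication adds up errors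
instead of compounding them. -/
theorem eventually_norm_chartMul_le :
    ∀ᶠ z in 𝓝 (0 : E × E), ‖chartMul E N z‖ ≤ ‖z.1‖ + 2 * ‖z.2‖ := by
  have h := (contDiffAt_chartMul (E := E) (N := N)).hasStrictFDerivAt (by simp)
  set m' := fderiv ℝ (chartMul E N) 0
  have h2 : ∀ y, m' (0, y) = y := by
    intro y
    have h := HasFDerivAt.comp (0 : E) (f := fun y : E => ((0 : E), y)) (g := chartMul E N)
      (g' := m') (f' := (0 : E →L[ℝ] E).prod (ContinuousLinearMap.id ℝ E)) h.hasFDerivAt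
      ((hasFDerivAt_const (0 : E) (0 : E)).prodMk (hasFDerivAt_id (0 : E)))
    have h0 : chartMul E N ∘ (fun y : E => ((0 : E), y)) =ᶠ[𝓝 0] id := by
      filter_upwards [eventually_identityChart_identityChartSymm (E := E) (N := N)] with v hv
      simpa [chartMul] using hv
    have := (h.congr_of_eventuallyEq h0.symm).unique (hasFDerivAt_id (0 : E))
    exact DFunLike.congr_fun this y
  have h1 := h.isLittleO.def (show (0 : ℝ) < 1 by norm_num)
  have ht : Tendsto (fun z : E × E => (z, (z.1, (0 : E)))) (𝓝 0) (𝓝 (0, (0, 0))) := by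
    have : Continuous (fun z : E × E => (z, (z.1, (0 : E)))) := by fun_prop
    simpa only [Prod.fst_zero] using this.tendsto 0
  filter_upwards [ht.eventually h1, (continuous_fst.tendsto (0 : E × E)).eventually
    (eventually_identityChart_identityChartSymm (N := N))] with z hz hz1
  have h3 : z - (z.1, (0 : E)) = (0, z.2) := by ext <;> simp
  have h4 : chartMul E N (z.1, 0) = z.1 := by
    simpa [chartMul] using (show identityChart E N (identityChartSymm E N z.1) = z.1 from hz1)
  simp only [h3, h2, h4, one_mul, Prod.norm_mk, norm_zero] at hz
  rw [max_eq_right (norm_nonneg _)] at hz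
  have h5 : chartMul E N z = (chartMul E N z - z.1 - z.2) + z.1 + z.2 := by abel
  rw [h5]
  have h6 := norm_add₃_le (a := chartMul E N z - z.1 - z.2) (b := z.1) (c := z.2)
  linarith

/-- Powers of elements near the identity grow at most linearly in the chart. -/
theorem exists_pow_eq_identityChartSymm : ∃ r > (0 : ℝ), ∀ (x : E) (n : ℕ), 2 * n * ‖x‖ < r →
    ∃ y, ‖y‖ ≤ 2 * n * ‖x‖ ∧ identityChartSymm E N y = identityChartSymm E N x ^ n := by
  obtain ⟨r, hr, hball⟩ := Metric.eventually_nhds_iff_ball.1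
    ((eventually_norm_chartMul_le (E := E) (N := N)).and (eventually_identityChartSymm_chartMul (N := N)))
  refine ⟨r, hr, fun x n => ?_⟩
  induction n with
  | zero => exact fun _ => ⟨0, by simp⟩
  | succ n ih =>
    intro hn
    push_cast at hn ⊢
    have hx0 := norm_nonneg x
    have hn0 : (0 : ℝ) ≤ n * ‖x‖ := by positivity
    obtain ⟨y, hy, hyx⟩ := ih (by nlinarith)
    obtain ⟨h1, h2⟩ := hball (y, x) (by
      rw [mem_ball_zero_iff]
      exact max_lt (by simp only; nlinarith) (by simp only; nlinarith))
    exact ⟨chartMul E N (y, x), by simp only at h1; linarith, by rw [h2, pow_succ]; simp only [hyx]⟩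

/-- About `r / (4 * ‖x‖)` powers of `x` stay in the ball where `L ≤ K`. Dividing `K` by that number
of powers gives a bound linear in `‖x‖`. -/
theorem IsLength.eventually_stableLength_le_norm {L : N → ℝ} (hL : IsLength L) {K : ℝ}
    (hK : ∀ᶠ g in 𝓝 (1 : N), L g ≤ K) :
    ∃ C, ∀ᶠ x in 𝓝 (0 : E), stableLength L (identityChartSymm E N x) ≤ C * ‖x‖ := by
  obtain ⟨r₁, hr₁, hpow⟩ := exists_pow_eq_identityChartSymm (E := E) (N := N)
  obtain ⟨r₂, hr₂, hball⟩ := Metric.eventually_nhds_iff_ball.1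
    ((tendsto_identityChartSymm (E := E) (N := N)).eventually hK)
  set r := min r₁ r₂ with hr
  have hr0 : 0 < r := lt_min hr₁ hr₂
  have hK0 : 0 ≤ K := (hL.nonneg _).trans (hball 0 (Metric.mem_ball_self hr₂))
  refine ⟨8 * K / r, ?_⟩
  filter_upwards [Metric.ball_mem_nhds (0 : E) (show (0 : ℝ) < r / 4 by positivity)] with x hx
  rw [mem_ball_zero_iff] at hx
  by_cases hx0 : x = 0
  · simp [hx0, hL.stableLength_one]
  have hx1 : 0 < ‖x‖ := norm_pos_iff.2 hx0
  set a := r / (4 * ‖x‖) with ha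
  have ha1 : 1 ≤ a := by rw [ha, le_div_iff₀ (by positivity)]; linarith
  have hax : a * ‖x‖ = r / 4 := by rw [ha]; field_simp
  set n := ⌊a⌋₊ with hn
  -- Since `a ≥ 1`, rounding down loses at most a factor `2`; hence `r / 8 ≤ n * ‖x‖` and the
  -- constant `8 * K / r`.
  have hn1 : (1 : ℝ) ≤ n := by exact_mod_cast Nat.le_floor (by simpa using ha1)
  have hna : (n : ℝ) ≤ a := Nat.floor_le (by linarith)
  have han : a < n + 1 := Nat.lt_floor_add_one a
  have h1 : (n : ℝ) * ‖x‖ ≤ r / 4 := hax ▸ mul_le_mul_of_nonneg_right hna hx1.le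
  have h2 : r / 8 ≤ n * ‖x‖ := by nlinarith
  have hrr₁ : r ≤ r₁ := min_le_left _ _
  have hrr₂ : r ≤ r₂ := min_le_right _ _
  obtain ⟨y, hy, hyx⟩ := hpow x n (by linarith)
  have h3 : L (identityChartSymm E N x ^ n) ≤ K := by
    rw [← hyx]; exact hball y (by rw [mem_ball_zero_iff]; linarith)
  have h4 := (hL.mul_stableLength_le (identityChartSymm E N x) n).trans h3
  have h5 := hL.stableLength_nonneg (identityChartSymm E N x)
  rw [div_mul_eq_mul_div, le_div_iff₀ hr0]
  have h6 : n * stableLength L (identityChartSymm E N x) * ‖x‖ ≤ K * ‖x‖ := by gcongr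
  have h7 : r / 8 * stableLength L (identityChartSymm E N x) ≤
      n * ‖x‖ * stableLength L (identityChartSymm E N x) := by gcongr
  nlinarith

omit [LieGroup 𝓘(ℝ, E) ∞ N] in
theorem LieGroupAut.hasFDerivAt_identityChart (β : LieGroupAut E N) :
    HasFDerivAt (fun v => identityChart E N (β.toMulEquiv (identityChartSymm E N v)))
      (mfderiv 𝓘(ℝ, E) 𝓘(ℝ, E) β.toMulEquiv (1 : N) : E →L[ℝ] E) 0 := by
  have hd : MDifferentiableAt 𝓘(ℝ, E) 𝓘(ℝ, E) β.toMulEquiv (1 : N) :=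
    (β.contMDiff_toFun (1 : N)).mdifferentiableAt (by simp)
  have h := hd.hasMFDerivAt.2
  have hw : writtenInExtChartAt 𝓘(ℝ, E) 𝓘(ℝ, E) (1 : N) β.toMulEquiv =
      extChartAt 𝓘(ℝ, E) (1 : N) ∘ β.toMulEquiv ∘ (extChartAt 𝓘(ℝ, E) (1 : N)).symm := by
    simp only [writtenInExtChartAt, map_one]
  rw [hw, modelWithCornersSelf_coe, Set.range_id] at h
  set p := extChartAt 𝓘(ℝ, E) (1 : N) 1 with hp
  have h2 : HasFDerivAt (fun v : E => p + v) (ContinuousLinearMap.id ℝ E) 0 :=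
    (hasFDerivAt_id (0 : E)).const_add p
  have h' : HasFDerivAt
      (extChartAt 𝓘(ℝ, E) (1 : N) ∘ β.toMulEquiv ∘ (extChartAt 𝓘(ℝ, E) (1 : N)).symm)
      (mfderiv 𝓘(ℝ, E) 𝓘(ℝ, E) β.toMulEquiv (1 : N) : E →L[ℝ] E) (p + 0) := by
    rw [add_zero]; exact hasFDerivWithinAt_univ.1 h
  exact (HasFDerivAt.comp (0 : E) h' h2).sub_const p

/-- A stable length on a Lie group that is locally bounded, subadditive and invariant under a
hyperbolic automorphism vanishes near the identity. -/
theorem IsLength.eventually_stableLength_eq_zero [FiniteDimensional ℝ E] [Group.IsNilpotent N]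
    {L : N → ℝ} (hL : IsLength L) {K : ℝ} (hK : ∀ᶠ g in 𝓝 (1 : N), L g ≤ K)
    (β : LieGroupAut E N) (hβ : NoEigenvalueOnUnitCircle β.differential)
    (hβL : ∀ g, stableLength L (β.toMulEquiv g) = stableLength L g) :
    ∀ᶠ g in 𝓝 (1 : N), stableLength L g = 0 := by
  obtain ⟨C, hC⟩ := hL.eventually_stableLength_le_norm (E := E) hK
  have hβ1 : Tendsto β.toMulEquiv (𝓝 1) (𝓝 1) := by
    simpa using (β.contMDiff_toFun.continuous.tendsto 1)
  have key : ∀ᶠ x in 𝓝 (0 : E), stableLength L (identityChartSymm E N x) = 0 := by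
    refine eventually_eq_zero_of_noEigenvalueOnUnitCircle
      (f := fun x => stableLength L (identityChartSymm E N x))
      (b := fun v => identityChart E N (β.toMulEquiv (identityChartSymm E N v)))
      (by simp [hL.stableLength_one]) hC (q := chartLeftDiv E N) (fun x => by simp [chartLeftDiv])
      hasStrictFDerivAt_chartLeftDiv ?_ (by simp) β.hasFDerivAt_identityChart ?_ hβ
    · filter_upwards [eventually_identityChartSymm_chartLeftDiv (E := E) (N := N)] with z hz
      set g := identityChartSymm E N z.1
      set h := identityChartSymm E N z.2
      rw [hz]
      refine ⟨?_, ?_, ?_⟩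
      · simpa [hL.stableLength_inv] using hL.stableLength_mul_le g⁻¹ h
      · have h1 := hL.stableLength_mul_le h (g⁻¹ * h)⁻¹
        rw [hL.stableLength_inv] at h1
        simpa using h1
      · simpa using hL.stableLength_mul_le g (g⁻¹ * h)
    · filter_upwards [(hβ1.comp (tendsto_identityChartSymm (E := E) (N := N))).eventually
        (eventually_identityChartSymm_identityChart (E := E))] with x hx
      simp only [Function.comp_apply] at hx
      rw [hx, hβL]
  filter_upwards [(tendsto_identityChart (E := E) (N := N)).eventually key,
    eventually_identityChartSymm_identityChart (E := E) (N := N)] with g h1 h2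
  rwa [h2] at h1

end Smooth

end Chart

/-! ### Extending a homomorphism from a cocompact lattice -/

section Lattice

variable {G : Type*} [Group G] [TopologicalSpace G] [IsTopologicalGroup G]

theorem IsLatticeSubgroup.exists_isCompact [LocallyCompactSpace G] [SecondCountableTopology G]
    [T2Space G] [Group.IsNilpotent G] {Γ : Subgroup G} (hΓ : IsLatticeSubgroup Γ) :
    ∃ K : Set G, IsCompact K ∧ ∀ g : G, ∃ c ∈ K, c⁻¹ * g ∈ Γ := by
  obtain ⟨hdisc, μ, hμ, hfin, hinv⟩ := hΓ
  let _ : MeasurableSpace (G ⧸ Γ) := borel (G ⧸ Γ)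
  have : BorelSpace (G ⧸ Γ) := ⟨rfl⟩
  exact exists_isCompact_mul_eq_univ Subgroup.isClosed_of_discrete μ hμ

theorem Subgroup.finite_preimage_of_isCompact [T2Space G] (Γ : Subgroup G) [DiscreteTopology Γ]
    {K : Set G} (hK : IsCompact K) : ((↑) ⁻¹' K : Set Γ).Finite := by
  have hc : IsClosed (Γ : Set G) := Subgroup.isClosed_of_discrete
  exact (hc.isClosedEmbedding_subtypeVal.isCompact_preimage hK).finite_of_discrete

/-- A homomorphism to `ℤ` on a discrete cocompact subgroup extends to an equivariant function that
is displaced boundedly by left translations from a compact set. -/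
theorem exists_equivariant_extension [T2Space G] (Γ : Subgroup G) [DiscreteTopology Γ] {C : Set G}
    (hC : IsCompact C) (hCΓ : ∀ g : G, ∃ c ∈ C, c⁻¹ * g ∈ Γ) (k : Γ →* Multiplicative ℤ) :
    ∃ F : G → ℝ, (∀ (g : G) (γ : Γ), F (g * γ) = F g + (k γ).toAdd) ∧
      ∀ V : Set G, IsCompact V → ∃ R, ∀ u ∈ V, ∀ x, |F (u * x) - F x| ≤ R := by
  have hs : ∀ q : G ⧸ Γ, ∃ c ∈ C, (c : G ⧸ Γ) = q := by
    intro q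
    obtain ⟨g, rfl⟩ := QuotientGroup.mk_surjective q
    obtain ⟨c, hc, hcg⟩ := hCΓ g
    exact ⟨c, hc, QuotientGroup.eq.2 hcg⟩
  choose s hsC hs using hs
  have hmem : ∀ g : G, (s g)⁻¹ * g ∈ Γ := fun g => QuotientGroup.eq.1 (hs g)
  -- `s` is a section of `G → G ⧸ Γ` with values in `C`, and `F` applies `k` to the lattice part of
  -- `g`.
  let F : G → ℝ := fun g => (k ⟨(s g)⁻¹ * g, hmem g⟩).toAdd
  refine ⟨F, fun g γ => ?_, fun V hV => ?_⟩
  · have h1 : (⟨(s (g * γ : G))⁻¹ * (g * γ), hmem _⟩ : Γ) = ⟨(s g)⁻¹ * g, hmem g⟩ * γ := by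
      refine Subtype.ext ?_
      have : ((g * γ : G) : G ⧸ Γ) = g := by rw [QuotientGroup.eq]; simp
      simp only [this, Subgroup.coe_mul, mul_assoc]
    simp only [F, h1, map_mul, toAdd_mul, Int.cast_add]
  -- The displacement is `k` of an element of `Γ` in the compact set `C⁻¹ * V * C`, which leaves
  -- finitely many values.
  · have hfin := Γ.finite_preimage_of_isCompact ((hC.inv.mul hV).mul hC)
    obtain ⟨R, hR⟩ := (hfin.image fun γ => |((k γ).toAdd : ℝ)|).bddAbove
    refine ⟨R, fun u hu x => hR ?_⟩
    let δ : Γ := ⟨(s (u * x : G))⁻¹ * (u * x), hmem _⟩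
    let δ' : Γ := ⟨(s x)⁻¹ * x, hmem x⟩
    refine ⟨δ * δ'⁻¹, ?_, ?_⟩
    · have h1 : ((δ * δ'⁻¹ : Γ) : G) = (s (u * x : G))⁻¹ * u * s x := by
        simp only [δ, δ', Subgroup.coe_mul, Subgroup.coe_inv]; group
      rw [Set.mem_preimage, h1]
      exact Set.mul_mem_mul (Set.mul_mem_mul (Set.inv_mem_inv.2 (hsC _)) hu) (hsC _)
    · simp [F, δ, δ', sub_eq_add_neg]

end Lattice

/-! ### The displacement length and its invariance -/

section Displacement

variable {G : Type*} [Group G]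

/-- The supremum of the displacement of `F` under a left translation. -/
noncomputable def displacement (F : G → ℝ) (u : G) : ℝ := ⨆ x, |F (u * x) - F x|

variable {F : G → ℝ}

theorem le_displacement (hF : ∀ u, ∃ R, ∀ x, |F (u * x) - F x| ≤ R) (u x : G) :
    |F (u * x) - F x| ≤ displacement F u := by
  obtain ⟨R, hR⟩ := hF u
  exact le_ciSup (f := fun x => |F (u * x) - F x|) ⟨R, by rintro _ ⟨x, rfl⟩; exact hR x⟩ x

theorem displacement_le {u : G} {R : ℝ} (h : ∀ x, |F (u * x) - F x| ≤ R) : displacement F u ≤ R :=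
  ciSup_le h

theorem isLength_displacement (hF : ∀ u, ∃ R, ∀ x, |F (u * x) - F x| ≤ R) :
    IsLength (displacement F) := by
  have hinv : ∀ u, displacement F u⁻¹ ≤ displacement F u := fun u => displacement_le fun x => by
    have := le_displacement hF u (u⁻¹ * x)
    rwa [mul_inv_cancel_left, abs_sub_comm] at this
  refine ⟨fun u => (abs_nonneg _).trans (le_displacement hF u 1), fun u v => ?_, fun u => ?_, ?_⟩
  · refine displacement_le fun x => ?_
    have h1 := le_displacement hF u (v * x)
    have h2 := le_displacement hF v x
    rw [← mul_assoc] at h1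
    exact (abs_sub_le _ (F (v * x)) _).trans (add_le_add h1 h2)
  · exact le_antisymm (hinv u) (by simpa using hinv u⁻¹)
  · simp [displacement]

/-- The displacements of `β g ^ n` and `g ^ n` differ by at most `2 * M` for every `n`, which
disappears after division by `n`. -/
theorem stableLength_displacement_mulEquiv (hF : ∀ u, ∃ R, ∀ x, |F (u * x) - F x| ≤ R)
    (β : G ≃* G) {M : ℝ} (hM : ∀ x, |F (β x) - F x| ≤ M) (g : G) :
    stableLength (displacement F) (β g) = stableLength (displacement F) g := by
  have hL := isLength_displacement hF
  refine le_antisymm ?_ ?_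
  · refine hL.stableLength_le_of_bounded hL _ _ (2 * M) fun n => displacement_le fun x => ?_
    obtain ⟨y, rfl⟩ := β.surjective x
    have h1 := abs_le.1 (hM (g ^ n * y))
    have h2 := abs_le.1 (hM y)
    have h3 := abs_le.1 (le_displacement hF (g ^ n) y)
    rw [← map_pow, ← map_mul, abs_le]
    constructor <;> linarith
  · refine hL.stableLength_le_of_bounded hL _ _ (2 * M) fun n => displacement_le fun y => ?_
    have h1 := abs_le.1 (hM (g ^ n * y))
    have h2 := abs_le.1 (hM y)
    have h3 := abs_le.1 (le_displacement hF (β g ^ n) (β y))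
    rw [← map_pow, ← map_mul] at h3
    rw [abs_le, ← map_pow]
    constructor <;> linarith

/-- A subadditive stable length that vanishes near the identity of a connected group is zero. -/
theorem IsLength.stableLength_eq_zero_of_eventually [TopologicalSpace G] [IsTopologicalGroup G]
    [PreconnectedSpace G] [Group.IsNilpotent G] {L : G → ℝ} (hL : IsLength L)
    (h : ∀ᶠ g in 𝓝 (1 : G), stableLength L g = 0) (g : G) : stableLength L g = 0 := by
  -- Subadditivity makes the zero set a subgroup; containing a neighbourhood of `1`, it is open and
  -- closed.
  let S : Subgroup G :=
    { carrier := {g | stableLength L g = 0}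
      one_mem' := hL.stableLength_one
      mul_mem' := fun {a b} (ha : _ = _) (hb : _ = _) => le_antisymm
        ((hL.stableLength_mul_le a b).trans (by rw [ha, hb, add_zero])) (hL.stableLength_nonneg _)
      inv_mem' := fun {a} (ha : _ = _) => (hL.stableLength_inv a).trans ha }
  have hS : IsOpen (S : Set G) := S.isOpen_of_mem_nhds h
  have huniv : (S : Set G) = Set.univ :=
    IsClopen.eq_univ ⟨S.isClosed_of_isOpen hS, hS⟩ ⟨1, S.one_mem⟩
  have : g ∈ (S : Set G) := huniv ▸ Set.mem_univ g
  exact this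

end Displacement

end

theorem mainTheorem3
    {E : Type*} [NormedAddCommGroup E] [NormedSpace ℝ E] [FiniteDimensional ℝ E]
    {N : Type*} [TopologicalSpace N] [ChartedSpace E N] [Group N]
    [LieGroup 𝓘(ℝ, E) ∞ N] [T2Space N] [SecondCountableTopology N]
    [SimplyConnectedSpace N] [Group.IsNilpotent N]
    (Λ Γ : Subgroup N) (hΛ : IsLatticeSubgroup Λ) (hΓ : IsLatticeSubgroup Γ) (hΛΓ : Λ ≤ Γ)
    (β : LieGroupAut E N) (hβ : NoEigenvalueOnUnitCircle β.differential)
    (hβΛ : ∀ x ∈ Λ, β.toMulEquiv x ∈ Γ)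
    (k : Γ →* Multiplicative ℤ)
    (hk : ∀ (x : N) (hx : x ∈ Λ), k ⟨β.toMulEquiv x, hβΛ x hx⟩ = k ⟨x, hΛΓ hx⟩) :
    k = 1 := by
  have : IsTopologicalGroup N := topologicalGroup_of_lieGroup 𝓘(ℝ, E) ∞
  have : LocallyCompactSpace N := Manifold.locallyCompact_of_finiteDimensional 𝓘(ℝ, E)
  have : DiscreteTopology Γ := hΓ.1
  obtain ⟨C, hC, hCΓ⟩ := hΓ.exists_isCompact
  obtain ⟨D, hD, hDΛ⟩ := hΛ.exists_isCompact
  obtain ⟨F, hFk, hFV⟩ := exists_equivariant_extension Γ hC hCΓ k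
  have hF : ∀ u, ∃ R, ∀ x, |F (u * x) - F x| ≤ R := fun u => by
    obtain ⟨R, hR⟩ := hFV {u} isCompact_singleton
    exact ⟨R, hR u rfl⟩
  have hL := isLength_displacement hF
  -- Write `x = d * λ` with `d` in the compact set `D` and `λ ∈ Λ`. The terms `k (β λ)` and `k λ`
  -- cancel, leaving `F (β d) - F d`, and both values are close to `F 1`.
  have hbdd : ∃ M, ∀ x, |F (β.toMulEquiv x) - F x| ≤ M := by
    obtain ⟨R, hR⟩ := hFV D hD
    obtain ⟨R', hR'⟩ := hFV (β.toMulEquiv '' D) (hD.image β.contMDiff_toFun.continuous)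
    refine ⟨R + R', fun x => ?_⟩
    obtain ⟨d, hd, hdx⟩ := hDΛ x
    have hx : x = d * (d⁻¹ * x) := by group
    have h1 := hFk d ⟨d⁻¹ * x, hΛΓ hdx⟩
    have h2 := hFk (β.toMulEquiv d) ⟨β.toMulEquiv (d⁻¹ * x), hβΛ _ hdx⟩
    rw [hk _ hdx] at h2
    simp only at h1 h2
    rw [← map_mul, ← hx] at h2
    rw [← hx] at h1
    have h3 := abs_le.1 (hR d hd 1)
    have h4 := abs_le.1 (hR' _ ⟨d, hd, rfl⟩ 1)
    rw [mul_one] at h3 h4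
    rw [h1, h2, abs_le]
    constructor <;> linarith
  obtain ⟨M, hM⟩ := hbdd
  obtain ⟨V, hV, hV1⟩ := exists_compact_mem_nhds (1 : N)
  obtain ⟨R, hR⟩ := hFV V hV
  have hzero := hL.stableLength_eq_zero_of_eventually (hL.eventually_stableLength_eq_zero (K := R)
    (Filter.mem_of_superset hV1 fun u hu => displacement_le (hR u hu)) β hβ
    (stableLength_displacement_mulEquiv hF β.toMulEquiv hM))
  ext γ
  have hpow : ∀ n : ℕ, |((k γ).toAdd : ℝ)| * n ≤ displacement F ((γ : N) ^ n) := by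
    intro n
    have h1 := hFk 1 (γ ^ n)
    have h2 := le_displacement hF ((γ : N) ^ n) 1
    rw [one_mul] at h1
    rw [mul_one, ← Subgroup.coe_pow, h1, add_sub_cancel_left] at h2
    simpa [abs_mul, mul_comm] using h2
  have hle := le_stableLength fun n _ => hpow n
  rw [hzero] at hle
  have h0 : ((k γ).toAdd : ℝ) = 0 := abs_eq_zero.1 (le_antisymm hle (abs_nonneg _))
  simpa using h0
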